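/- Let $d\in\mathbb N$ and $I=[0,1]$. Let $\mathcal S(\mathbb R^d,\mathbb R^d)$ be the Schwartz space with its Fréchet topology; for compact $K\subseteq\mathbb R^d$ let $\mathcal D_K(\mathbb R^d,\mathbb R^d)$ be the Fréchet space of smooth maps $\mathbb R^d\to\mathbb R^d$ vanishing outside $K$ (with the topology of uniform convergence of all derivatives), and let $\mathcal D(\mathbb R^d,\mathbb R^d)$ be the space of smooth compactly supported maps with its (LF)-topology, the locally convex inductive limit of the spaces $\mathcal D_K(\mathbb R^d,\mathbb R^d)$. For a locally convex space $E$, a function $f:I\to E$ is *integrable by seminorm* if for each continuous seminorm $p$ on $E$ there are simple functions $f^p_n:I\to E$ (Lebesgue measurable with finitely many values), $n\in\mathbb N$, such that $p(f_n^p(t)-f(t))\to0$ for almost every $t\in I$, $p\circ(f_n^p-f)\in L^1(I)$ for all $n$, and such that for each measurable $J\subseteq I$ there is $F_J\in E$ with $p\big(F_J-\int_J f_n^p(t)\,dt\big)\to0$ as $n\to\infty$ for all continuous seminorms $p$. Let $L^1(I,E)$ be the space of these functions with the topology defined by the seminorms $\tilde p(f)=\int_0^1 p(f(t))\,dt$,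 modulo the subspace of those $f$ with $\tilde p(f)=0$ for all $p$. Let $C(I,E)$ carry the topology of uniform convergence (that is, the compact-open topology). Let $E=\mathcal S(\mathbb R^d,\mathbb R^d)$ or $E=\mathcal D_K(\mathbb R^d,\mathbb R^d)$ with $K\subseteq\mathbb R^d$ compact. Then each time-dependent vector field $u\in L^1(I,E)$ has a unique flow $\Phi_u:I\times\mathbb R^d\to\mathbb R^d$, that is, for each $x\in\mathbb R^d$ the curve $t\mapsto\Phi_u(t,x)$ is continuous and $$\Phi_u(t,x)=x+\int_0^t u(s)(\Phi_u(s,x))\,ds,\qquad t\in I$$ (the integrand being integrable), and $\Phi_u$ does not depend on the representative of $u$. With $\varphi_u(t)(x):=\Phi_u(t,x)-x$, the mappings $$L^1(I,\mathcal S(\mathbb R^d,\mathbb R^d))\ni u\mapsto\varphi_u\in C(I,\mathcal S(\mathbb R^d,\mathbb R^d)),$$ $$L^1(I,\mathcal D_K(\mathbb R^d,\mathbb R^d))\ni u\mapsto\varphi_u\in C(I,\mathcal D(\mathbb R^d,\mathbb R^d)),\qquad K\subseteq\mathbb R^d\text{ compact},$$ are well defined and continuous. -/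

import Mathlib

open MeasureTheory Filter Topology TopologicalSpace
open scoped unitInterval SchwartzMap Distributions

noncomputable section

namespace SeminormIntegral

section General

variable {E : Type*} [AddCommGroup E] [Module ℝ E]

/-- A simple function on `[0,1]`: Lebesgue measurable with finitely many values. -/
structure IsSimple {X : Type*} (f : I → X) : Prop where
  finite_range : (Set.range f).Finite
  measurable_fiber : ∀ y : X, NullMeasurableSet (f ⁻¹' {y}) (volume : Measure I)

/-- The integral `∑ y, λ (f⁻¹{y} ∩ J) • y` of a simple function over `J ⊆ [0,1]`
(a finite sum, since the fibre of `y` is empty for `y` outside the finite range of `f`). -/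
def simpleIntegral (f : I → E) (J : Set I) : E :=
  ∑ᶠ y : E, (volume : Measure I).real (f ⁻¹' {y} ∩ J) • y

/-- `a p n` are simple functions which, for each continuous seminorm `p`, approximate `f` almost
everywhere with respect to `p`. -/
structure IsApprox [TopologicalSpace E] (a : Seminorm ℝ E → ℕ → I → E) (f : I → E) : Prop where
  simple : ∀ p : Seminorm ℝ E, Continuous p → ∀ n, IsSimple (a p n)
  tendsto : ∀ p : Seminorm ℝ E, Continuous p →
    ∀ᵐ t : I, Tendsto (fun n => p (a p n t - f t)) atTop (𝓝 0)

/-- A curve `f : [0,1] → E` is measurable by seminorm. -/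
def MeasurableBySeminorm [TopologicalSpace E] (f : I → E) : Prop :=
  ∃ a : Seminorm ℝ E → ℕ → I → E, IsApprox a f

/-- A curve `f : [0,1] → E` is integrable by seminorm: it is measurable by seminorm, the
approximating simple functions can be taken at integrable distance from `f`, and for each measurable
`J` there is a vector in `E` (the integral of `f` over `J`) which is, for each
continuous seminorm `p`, the `p`-limit of the integrals of the approximating simple functions. -/
def IntegrableBySeminorm [TopologicalSpace E] (f : I → E) : Prop :=
  ∃ a : Seminorm ℝ E → ℕ → I → E, IsApprox a f ∧
    (∀ p : Seminorm ℝ E, Continuous p → ∀ n, Integrable (fun t => p (a p n t - f t))) ∧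
    ∀ J : Set I, NullMeasurableSet J (volume : Measure I) →
      ∃ F : E, ∀ p : Seminorm ℝ E, Continuous p →
        Tendsto (fun n => p (F - simpleIntegral (a p n) J)) atTop (𝓝 0)

lemma simpleIntegral_comp {X : Type*} {h : I → X} (hh : IsSimple h) (G : X → E)
    {J : Set I} (hJ : NullMeasurableSet J (volume : Measure I)) :
    simpleIntegral (fun t => G (h t)) J =
      ∑ x ∈ hh.finite_range.toFinset, (volume : Measure I).real (h ⁻¹' {x} ∩ J) • G x := by
  classical
  set S := hh.finite_range.toFinset with hS
  have hmem : ∀ t, h t ∈ S := fun t => by simp [hS]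
  have key : ∀ y : E, (volume : Measure I).real ((fun t => G (h t)) ⁻¹' {y} ∩ J) =
      ∑ x ∈ S with G x = y, (volume : Measure I).real (h ⁻¹' {x} ∩ J) := by
    intro y
    rw [← measureReal_biUnion_finset₀]
    · congr 1
      ext t
      simp only [Set.mem_inter_iff, Set.mem_preimage, Set.mem_singleton_iff, Set.mem_iUnion,
        Finset.mem_filter]
      constructor
      · rintro ⟨h1, h2⟩
        exact ⟨h t, ⟨hmem t, h1⟩, rfl, h2⟩
      · rintro ⟨x, ⟨-, hx⟩, rfl, h2⟩
        exact ⟨hx, h2⟩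
    · intro x _ y _ hxy
      refine Disjoint.aedisjoint ?_
      rw [Set.disjoint_left]
      rintro t ⟨h1, -⟩ ⟨h2, -⟩
      exact hxy (h1.symm.trans h2)
    · intro x _
      exact (hh.measurable_fiber x).inter hJ
  unfold simpleIntegral
  rw [finsum_eq_sum_of_support_subset (s := S.image G)]
  · rw [← Finset.sum_fiberwise_of_maps_to (s := S) (t := S.image G) (g := G)
      (fun x hx => Finset.mem_image_of_mem G hx)]
    refine Finset.sum_congr rfl fun y _ => ?_
    rw [key y, Finset.sum_smul]
    refine Finset.sum_congr rfl fun x hx => ?_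
    rw [(Finset.mem_filter.1 hx).2]
  · intro y hy
    by_contra hny
    apply hy
    have : (fun t => G (h t)) ⁻¹' {y} = ∅ := by
      ext t
      simp only [Set.mem_preimage, Set.mem_singleton_iff, Set.mem_empty_iff_false, iff_false]
      rintro rfl
      exact hny (by simpa using ⟨h t, hmem t, rfl⟩)
    simp [this]

lemma IsSimple.comp {X Y : Type*} {h : I → X} (hh : IsSimple h) (G : X → Y) :
    IsSimple (fun t => G (h t)) := by
  refine ⟨(hh.finite_range.image G).subset ?_, fun y => ?_⟩
  · rintro _ ⟨t, rfl⟩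
    exact ⟨h t, ⟨t, rfl⟩, rfl⟩
  · have : (fun t => G (h t)) ⁻¹' {y} = ⋃ x ∈ Set.range h ∩ G ⁻¹' {y}, h ⁻¹' {x} := by
      ext t
      simp only [Set.mem_preimage, Set.mem_singleton_iff, Set.mem_iUnion, exists_prop]
      exact ⟨fun ht => ⟨h t, ⟨⟨t, rfl⟩, ht⟩, rfl⟩, by rintro ⟨x, ⟨-, hx⟩, rfl⟩; exact hx⟩
    rw [this]
    exact NullMeasurableSet.biUnion (hh.finite_range.subset Set.inter_subset_left).countable
      fun x _ => hh.measurable_fiber x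

lemma IsSimple.prodMk {X Y : Type*} {f : I → X} {g : I → Y} (hf : IsSimple f) (hg : IsSimple g) :
    IsSimple (fun t => (f t, g t)) := by
  refine ⟨(hf.finite_range.prod hg.finite_range).subset ?_, fun y => ?_⟩
  · rintro _ ⟨t, rfl⟩
    exact ⟨⟨t, rfl⟩, ⟨t, rfl⟩⟩
  · have : (fun t => (f t, g t)) ⁻¹' {y} = f ⁻¹' {y.1} ∩ g ⁻¹' {y.2} := by
      ext t
      simp [Prod.ext_iff]
    rw [this]
    exact (hf.measurable_fiber _).inter (hg.measurable_fiber _)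

lemma simpleIntegral_add {f g : I → E} (hf : IsSimple f) (hg : IsSimple g)
    {J : Set I} (hJ : NullMeasurableSet J (volume : Measure I)) :
    simpleIntegral (fun t => f t + g t) J = simpleIntegral f J + simpleIntegral g J := by
  have h := hf.prodMk hg
  rw [show simpleIntegral f J = _ from simpleIntegral_comp h Prod.fst hJ,
    show simpleIntegral g J = _ from simpleIntegral_comp h Prod.snd hJ,
    simpleIntegral_comp h (fun z => z.1 + z.2) hJ, ← Finset.sum_add_distrib]
  exact Finset.sum_congr rfl fun x _ => smul_add _ _ _

lemma simpleIntegral_smul (c : ℝ) {f : I → E} (hf : IsSimple f)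
    {J : Set I} (hJ : NullMeasurableSet J (volume : Measure I)) :
    simpleIntegral (fun t => c • f t) J = c • simpleIntegral f J := by
  rw [show simpleIntegral f J = _ from simpleIntegral_comp hf id hJ,
    simpleIntegral_comp hf (fun z => c • z) hJ, Finset.smul_sum]
  exact Finset.sum_congr rfl fun x _ => smul_comm _ _ _

lemma isSimple_const {X : Type*} (x : X) : IsSimple (fun _ : I => x) :=
  ⟨(Set.finite_singleton x).subset (by rintro _ ⟨_, rfl⟩; rfl),
    fun y => (MeasurableSet.const (x = y)).nullMeasurableSet⟩

lemma IsSimple.aestronglyMeasurable {f : I → ℝ} (hf : IsSimple f) :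
    AEStronglyMeasurable f (volume : Measure I) := by
  refine NullMeasurable.aemeasurable (fun s _ => ?_) |>.aestronglyMeasurable
  have : f ⁻¹' s = ⋃ x ∈ Set.range f ∩ s, f ⁻¹' {x} := by
    ext t
    simp only [Set.mem_preimage, Set.mem_singleton_iff, Set.mem_iUnion, exists_prop]
    exact ⟨fun ht => ⟨f t, ⟨⟨t, rfl⟩, ht⟩, rfl⟩, by rintro ⟨x, ⟨-, hx⟩, rfl⟩; exact hx⟩
  rw [this]
  exact NullMeasurableSet.biUnion (hf.finite_range.subset Set.inter_subset_left).countable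
    fun x _ => hf.measurable_fiber x

lemma aestronglyMeasurable_of_approx (p : Seminorm ℝ E) {s : ℕ → I → E} {h : I → E}
    (hs : ∀ m, IsSimple (s m)) (hl : ∀ᵐ t : I, Tendsto (fun m => p (s m t - h t)) atTop (𝓝 0)) :
    AEStronglyMeasurable (fun t => p (h t)) (volume : Measure I) := by
  refine aestronglyMeasurable_of_tendsto_ae atTop
    (fun m => ((hs m).comp p).aestronglyMeasurable) ?_
  filter_upwards [hl] with t ht
  rw [tendsto_iff_dist_tendsto_zero]
  exact squeeze_zero (fun _ => dist_nonneg) (fun m => abs_sub_map_le_sub p _ _) ht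

lemma IsSimple.integrable {f : I → ℝ} (hf : IsSimple f) : Integrable f (volume : Measure I) := by
  obtain ⟨C, hC⟩ := hf.finite_range.isBounded.exists_norm_le
  exact Integrable.of_bound hf.aestronglyMeasurable C (ae_of_all _ fun t => hC _ ⟨t, rfl⟩)

variable [TopologicalSpace E]

lemma IntegrableBySeminorm.zero : IntegrableBySeminorm (fun _ : I => (0 : E)) := by
  refine ⟨fun _ _ _ => 0, ⟨fun _ _ _ => isSimple_const 0, fun p _ => ?_⟩, fun p _ n => ?_,
    fun J hJ => ⟨0, fun p _ => ?_⟩⟩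
  · simp
  · simp
  · have h0 : simpleIntegral (fun _ : I => (0 : E)) J = 0 := by
      rw [simpleIntegral_comp (isSimple_const (0 : E)) (fun _ => (0 : E)) hJ]
      simp
    simp [h0]

lemma IntegrableBySeminorm.add {f g : I → E} (hf : IntegrableBySeminorm f)
    (hg : IntegrableBySeminorm g) : IntegrableBySeminorm (fun t => f t + g t) := by
  obtain ⟨a, ha, ha', ha''⟩ := hf
  obtain ⟨b, hb, hb', hb''⟩ := hg
  have hs : ∀ p : Seminorm ℝ E, Continuous p → ∀ n, IsSimple (fun t => a p n t + b p n t) :=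
    fun p hp n => ((ha.simple p hp n).prodMk (hb.simple p hp n)).comp (fun z => z.1 + z.2)
  have hle : ∀ (p : Seminorm ℝ E) (x y z w : E), p (x + y - (z + w)) ≤ p (x - z) + p (y - w) :=
    fun p x y z w => by
      rw [add_sub_add_comm]
      exact map_add_le_add p _ _
  have hl : ∀ p : Seminorm ℝ E, Continuous p →
      ∀ᵐ t : I, Tendsto (fun n => p (a p n t + b p n t - (f t + g t))) atTop (𝓝 0) := by
    intro p hp
    filter_upwards [ha.tendsto p hp, hb.tendsto p hp] with t h1 h2
    refine squeeze_zero (fun _ => apply_nonneg p _) (fun n => hle p _ _ _ _) ?_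
    simpa using h1.add h2
  refine ⟨fun p n t => a p n t + b p n t, ⟨hs, hl⟩, fun p hp n => ?_, fun J hJ => ?_⟩
  · refine ((ha' p hp n).add (hb' p hp n)).mono' ?_ (ae_of_all _ fun t => ?_)
    · refine aestronglyMeasurable_of_approx p
        (s := fun m t => (a p n t + b p n t) - (a p m t + b p m t))
        (fun m => ((hs p hp n).prodMk (hs p hp m)).comp (fun z => z.1 - z.2)) ?_
      filter_upwards [hl p hp] with t ht
      refine ht.congr fun m => ?_
      rw [← map_neg_eq_map p]
      congr 1
      abel
    · rw [Real.norm_of_nonneg (apply_nonneg p _)]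
      exact hle p _ _ _ _
  · obtain ⟨F, hF⟩ := ha'' J hJ
    obtain ⟨G, hG⟩ := hb'' J hJ
    refine ⟨F + G, fun p hp => ?_⟩
    refine squeeze_zero (fun _ => apply_nonneg p _) (fun n => ?_)
      (by simpa using (hF p hp).add (hG p hp))
    rw [simpleIntegral_add (ha.simple p hp n) (hb.simple p hp n) hJ]
    exact hle p _ _ _ _

lemma IntegrableBySeminorm.smul (c : ℝ) {f : I → E} (hf : IntegrableBySeminorm f) :
    IntegrableBySeminorm (fun t => c • f t) := by
  obtain ⟨a, ha, ha', ha''⟩ := hf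
  have he : ∀ (p : Seminorm ℝ E) (x y : E), p (c • x - c • y) = ‖c‖ * p (x - y) :=
    fun p x y => by rw [← smul_sub, map_smul_eq_mul]
  refine ⟨fun p n t => c • a p n t, ⟨fun p hp n => (ha.simple p hp n).comp (fun z => c • z),
    fun p hp => ?_⟩, fun p hp n => ?_, fun J hJ => ?_⟩
  · filter_upwards [ha.tendsto p hp] with t ht
    simpa [he] using ht.const_mul ‖c‖
  · simpa only [he] using (ha' p hp n).const_mul ‖c‖
  · obtain ⟨F, hF⟩ := ha'' J hJ
    refine ⟨c • F, fun p hp => ?_⟩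
    simpa [simpleIntegral_smul c (ha.simple p hp _) hJ, he] using (hF p hp).const_mul ‖c‖

lemma IntegrableBySeminorm.integrable_seminorm {f : I → E} (hf : IntegrableBySeminorm f)
    (p : Seminorm ℝ E) (hp : Continuous p) : Integrable (fun t => p (f t)) := by
  obtain ⟨a, ha, ha', -⟩ := hf
  refine (((ha.simple p hp 0).comp p).integrable.add (ha' p hp 0)).mono'
    (aestronglyMeasurable_of_approx p (ha.simple p hp) (ha.tendsto p hp))
    (ae_of_all _ fun t => ?_)
  rw [Real.norm_of_nonneg (apply_nonneg p _)]
  have := map_sub_le_add p (a p 0 t) (a p 0 t - f t)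
  rwa [sub_sub_cancel] at this

variable (E) in
/-- The space `ℒ¹([0,1], E)` of curves integrable by seminorm, as a vector space. -/
def integrableSubmodule : Submodule ℝ (I → E) where
  carrier := {f | IntegrableBySeminorm f}
  zero_mem' := IntegrableBySeminorm.zero
  add_mem' := IntegrableBySeminorm.add
  smul_mem' c _ hf := IntegrableBySeminorm.smul c hf

variable (E) in
/-- The space `ℒ¹([0,1], E)`; it is kept apart from the submodule so that it does not
inherit the topology of pointwise convergence. -/
def PreL1 : Type _ := integrableSubmodule E

namespace PreL1

instance : AddCommGroup (PreL1 E) := inferInstanceAs (AddCommGroup (integrableSubmodule E))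

instance : Module ℝ (PreL1 E) := inferInstanceAs (Module ℝ (integrableSubmodule E))

instance : CoeFun (PreL1 E) (fun _ => I → E) := ⟨fun f => f.1⟩

lemma integrable_seminorm (f : PreL1 E) (p : Seminorm ℝ E) (hp : Continuous p) :
    Integrable (fun t => p (f t)) :=
  IntegrableBySeminorm.integrable_seminorm f.2 p hp

variable (E) in
/-- The seminorms `f ↦ ∫₀¹ p (f t) dt` on `ℒ¹([0,1], E)`, for `p` a continuous seminorm on `E`. -/
def seminorms : SeminormFamily ℝ (PreL1 E) {p : Seminorm ℝ E // Continuous p} := fun p =>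
  Seminorm.of (fun f => ∫ t, p.1 (f t))
    (fun f g => by
      rw [← integral_add (f.integrable_seminorm p.1 p.2) (g.integrable_seminorm p.1 p.2)]
      exact integral_mono ((f + g).integrable_seminorm p.1 p.2)
        ((f.integrable_seminorm p.1 p.2).add (g.integrable_seminorm p.1 p.2))
        fun t => map_add_le_add p.1 _ _)
    (fun c f => by
      rw [← integral_const_mul]
      exact integral_congr_ae (ae_of_all _ fun t => map_smul_eq_mul p.1 c (f t)))

instance : Nonempty {p : Seminorm ℝ E // Continuous p} :=
  ⟨⟨0, continuous_const⟩⟩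

/-- The (in general non-Hausdorff) locally convex topology given by the above seminorms. -/
instance : TopologicalSpace (PreL1 E) := (seminorms E).moduleFilterBasis.topology

variable (E) in
/-- The curves on which all of the above seminorms vanish. -/
def nullSubmodule : Submodule ℝ (PreL1 E) where
  carrier := {f | ∀ p, seminorms E p f = 0}
  zero_mem' p := map_zero _
  add_mem' {f g} hf hg p := le_antisymm
    ((map_add_le_add (seminorms E p) f g).trans (by rw [hf p, hg p, add_zero]))
    (apply_nonneg _ _)
  smul_mem' c f hf p := by rw [map_smul_eq_mul, hf p, mul_zero]

end PreL1

variable (E) in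
/-- The space `L¹([0,1], E)`, with its quotient topology. -/
abbrev L1 : Type _ := PreL1 E ⧸ PreL1.nullSubmodule E

end General

/-- `Φ` is a flow of the time-dependent vector field `u`: for each `x`, the continuous
curve `t ↦ Φ t x` satisfies `Φ t x = x + ∫₀ᵗ u s (Φ s x) ds`, with integrable integrand. -/
structure IsFlow {V : Type*} [NormedAddCommGroup V] [NormedSpace ℝ V]
    (u : I → V → V) (Φ : I → V → V) : Prop where
  continuous : ∀ x, Continuous fun t => Φ t x
  integrable : ∀ x, Integrable fun s => u s (Φ s x)
  eq_integral : ∀ t x, Φ t x = x + ∫ s in Set.Iic t, u s (Φ s x)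

/-- `φ` is the map `u ↦ φ_u` which sends the class in `L¹([0,1], E)` of a time-dependent vector
field `u` to the curve `φ_u : [0,1] → E'`, where `(t, x) ↦ x + φ_u t x` is the unique flow of `u`.
Here `E` and `E'` are spaces of maps `V → V`. -/
def IsFlowMap {V E E' : Type*} [NormedAddCommGroup V] [NormedSpace ℝ V]
    [AddCommGroup E] [Module ℝ E] [TopologicalSpace E] [FunLike E V V]
    [TopologicalSpace E'] [FunLike E' V V] (φ : L1 E → C(I, E')) : Prop :=
  ∀ u : PreL1 E,
    IsFlow (fun t => ⇑(u t)) (fun t x => x + φ (Submodule.Quotient.mk u) t x) ∧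
    ∀ Φ : I → V → V, IsFlow (fun t => ⇑(u t)) Φ →
      Φ = fun t x => x + φ (Submodule.Quotient.mk u) t x

end SeminormIntegral

end

/-!
The flow is constructed, for one time-dependent vector field `u` at a time, by calculus in the
Banach space `C(I, V)`. The trajectories are the solutions `γ` of `γ = x + N γ`, where `x` is a
constant curve and `N γ = (t ↦ ∫₀ᵗ u s (γ s) ds)`.

* `N` is the primitive of the superposition operator `γ ↦ (s ↦ u s (γ s))` from `C(I, V)` to
  `L¹(I, V)`. The latter is smooth, because its derivative is the superposition operator of
  `s ↦ D(u s)`, followed by the pointwise action of `L¹(I, V →L V)`; this also bounds its iterated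
  derivatives (`contDiff_superposition`, `norm_iteratedFDeriv_superposition_le`).
* For a supremum norm with an exponential weight, `N` is a contraction
  (`norm_lipschitzWeight_symm_sub_le`). So `1 - N` is bijective with smooth inverse. This gives
  existence and uniqueness of the flow, and smoothness of `x ↦ γ_x` as a map into `C(I, V)`, at
  one stroke.
* Differentiating `γ_x = x + N γ_x` repeatedly bounds all derivatives of `x ↦ γ_x`
  (`exists_forall_norm_iteratedFDeriv_le`). As a trajectory stays at bounded distance from its
  starting point, the decay of `u` then passes to the displacement `x ↦ γ_x - x = N γ_x`
  (`exists_norm_pow_mul_norm_iteratedFDeriv_le`): its Schwartz seminorms are bounded in terms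
  of the `L¹` seminorms of `u`.

By the Landau–Kolmogorov inequality, a family of Schwartz functions which is bounded in all
seminorms and tends to zero uniformly tends to zero in the Schwartz space
(`tendsto_zero_of_bounded_of_tendsto_seminorm_zero`). In view of the a priori bounds, continuity in
the time and in the vector field therefore only has to be checked for the uniform distance of
trajectories, where it is a Gronwall estimate (`norm_trajectory_sub_trajectory_le`,
`norm_trajectory_sub_trajectory_le_of_sub`).

For vector fields with support in a compact set `K`, the displacements have support in `K` as well,
and the topology of `𝓓_K` is induced by the Schwartz space (`isInducing_toSchwartzLM`), so that
this case reduces to the previous one.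
-/

open scoped ContDiff

noncomputable section

namespace SeminormIntegral

/-! ### Calculus in Banach spaces -/

section Calculus

variable {V F X : Type*} [NormedAddCommGroup V] [NormedSpace ℝ V] [NormedAddCommGroup F]
  [NormedSpace ℝ F] [NormedAddCommGroup X] [NormedSpace ℝ X]

lemma norm_image_add_sub_sub_fderiv_le {f : V → F} (hf : Differentiable ℝ f) {C : ℝ}
    (hC : ∀ x y, ‖fderiv ℝ f y - fderiv ℝ f x‖ ≤ C * ‖y - x‖) (hC0 : 0 ≤ C) (x v : V) :
    ‖f (x + v) - f x - fderiv ℝ f x v‖ ≤ C * ‖v‖ * ‖v‖ := by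
  have := Convex.norm_image_sub_le_of_norm_hasFDerivWithin_le' (𝕜 := ℝ) (f := f)
    (f' := fderiv ℝ f) (φ := fderiv ℝ f x) (s := Metric.closedBall x ‖v‖) (C := C * ‖v‖)
    (x := x) (y := x + v) (fun z _ => (hf z).hasFDerivAt.hasFDerivWithinAt)
    (fun z hz => (hC x z).trans (by
      rw [Metric.mem_closedBall, dist_eq_norm] at hz
      gcongr)) (convex_closedBall _ _) (Metric.mem_closedBall_self (norm_nonneg _)) (by simp)
  simpa using this

lemma norm_iteratedFDeriv_sub_le {f : V → F} (hf : ContDiff ℝ ∞ f) {n : ℕ} {C : ℝ}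
    (hC : ∀ x, ‖iteratedFDeriv ℝ (n + 1) f x‖ ≤ C) (x y : V) :
    ‖iteratedFDeriv ℝ n f y - iteratedFDeriv ℝ n f x‖ ≤ C * ‖y - x‖ := by
  refine Convex.norm_image_sub_le_of_norm_fderiv_le (𝕜 := ℝ) (s := Set.univ) (fun z _ => ?_)
    (fun z _ => ?_) convex_univ trivial trivial
  · exact (hf.differentiable_iteratedFDeriv (by exact_mod_cast WithTop.coe_lt_top _)) z
  · rw [norm_fderiv_iteratedFDeriv]
    exact hC z

lemma norm_fderiv_sub_le {f : V → F} (hf : ContDiff ℝ ∞ f) {C : ℝ}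
    (hC : ∀ x, ‖iteratedFDeriv ℝ 2 f x‖ ≤ C) (x y : V) :
    ‖fderiv ℝ f y - fderiv ℝ f x‖ ≤ C * ‖y - x‖ := by
  refine Convex.norm_image_sub_le_of_norm_fderiv_le (𝕜 := ℝ) (s := Set.univ) (fun z _ => ?_)
    (fun z _ => ?_) convex_univ trivial trivial
  · exact (hf.fderiv_right (m := 1) (by norm_cast)).differentiable (by norm_num) z
  · rw [← norm_iteratedFDeriv_one, norm_iteratedFDeriv_fderiv]
    exact hC z

/-- The Landau–Kolmogorov inequality, for the derivatives of orders `n`, `n + 1`, `n + 2`, with a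
free step size `h` in place of the optimal one. -/
lemma norm_iteratedFDeriv_succ_le {f : V → F} (hf : ContDiff ℝ ∞ f) {n : ℕ} {A B h : ℝ}
    (hA : ∀ x, ‖iteratedFDeriv ℝ n f x‖ ≤ A) (hB : ∀ x, ‖iteratedFDeriv ℝ (n + 2) f x‖ ≤ B)
    (hh : 0 < h) (x : V) : ‖iteratedFDeriv ℝ (n + 1) f x‖ ≤ 2 * A / h + B * h := by
  have hA0 : 0 ≤ A := (norm_nonneg _).trans (hA x)
  have hB0 : 0 ≤ B := (norm_nonneg _).trans (hB x)
  set g := iteratedFDeriv ℝ n f with hg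
  have hgd : Differentiable ℝ g :=
    hf.differentiable_iteratedFDeriv (by exact_mod_cast WithTop.coe_lt_top _)
  have hlip : ∀ x y, ‖fderiv ℝ g y - fderiv ℝ g x‖ ≤ B * ‖y - x‖ := by
    intro x y
    rw [hg, fderiv_iteratedFDeriv]
    simp only [Function.comp_apply]
    rw [← LinearIsometryEquiv.map_sub, LinearIsometryEquiv.norm_map]
    exact norm_iteratedFDeriv_sub_le hf hB x y
  rw [← norm_fderiv_iteratedFDeriv]
  refine ContinuousLinearMap.opNorm_le_of_unit_norm (by positivity) fun v hv => ?_
  have h1 := norm_image_add_sub_sub_fderiv_le hgd hlip hB0 x (h • v)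
  have h2 : ‖h • v‖ = h := by rw [norm_smul, hv, mul_one, Real.norm_of_nonneg hh.le]
  rw [h2, map_smul] at h1
  have h3 : h * ‖fderiv ℝ g x v‖ ≤ 2 * A + B * h * h := by
    calc h * ‖fderiv ℝ g x v‖ = ‖h • fderiv ℝ g x v‖ := by
          rw [norm_smul, Real.norm_of_nonneg hh.le]
      _ = ‖g (x + h • v) - g x - (g (x + h • v) - g x - h • fderiv ℝ g x v)‖ := by
          congr 1; abel
      _ ≤ ‖g (x + h • v)‖ + ‖g x‖ + B * h * h :=
          (norm_sub_le _ _).trans (add_le_add (norm_sub_le _ _) h1)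
      _ ≤ 2 * A + B * h * h := by linarith [hA (x + h • v), hA x]
  have : ‖fderiv ℝ g x v‖ ≤ (2 * A + B * h * h) / h := by
    rw [le_div_iff₀ hh]; linarith
  refine this.trans (le_of_eq ?_)
  field_simp

/-- A family of Schwartz functions which is bounded in every seminorm and tends to zero uniformly
tends to zero in the Schwartz space: the derivatives tend to zero uniformly by the
Landau–Kolmogorov inequality, and a weight `‖x‖ ^ k` is absorbed by
`(‖x‖ ^ k * a) ^ 2 = a * (‖x‖ ^ (2 * k) * a)`. -/
lemma tendsto_zero_of_bounded_of_tendsto_seminorm_zero {ι : Type*} {l : Filter ι}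
    {f : ι → 𝓢(V, F)}
    (hb : ∀ k n : ℕ, ∃ C : ℝ, ∀ᶠ i in l, SchwartzMap.seminorm ℝ k n (f i) ≤ C)
    (h0 : Tendsto (fun i => SchwartzMap.seminorm ℝ 0 0 (f i)) l (𝓝 0)) :
    Tendsto f l (𝓝 0) := by
  have key : ∀ n : ℕ, Tendsto (fun i => SchwartzMap.seminorm ℝ 0 n (f i)) l (𝓝 0) := by
    intro n
    induction n with
    | zero => exact h0
    | succ n ih =>
      obtain ⟨C, hC⟩ := hb 0 (n + 2)
      set C' := max C 1
      have hC'0 : 0 < C' := lt_max_of_lt_right one_pos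
      rw [Metric.tendsto_nhds]
      intro ε hε
      -- the step size `ε / (2 * C')` makes the contribution of order `n + 2` equal to `ε / 2`
      have h1 := ih.const_mul (2 / (ε / (2 * C')))
      rw [mul_zero] at h1
      filter_upwards [hC, h1.eventually (gt_mem_nhds (half_pos hε))] with i hi hi'
      rw [Real.dist_eq, sub_zero, abs_of_nonneg (apply_nonneg _ _)]
      have h2 : SchwartzMap.seminorm ℝ 0 (n + 1) (f i) ≤
          2 * SchwartzMap.seminorm ℝ 0 n (f i) / (ε / (2 * C')) + C' * (ε / (2 * C')) := by
        refine SchwartzMap.seminorm_le_bound ℝ 0 (n + 1) (f i) (by positivity) fun x => ?_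
        rw [pow_zero, one_mul]
        exact norm_iteratedFDeriv_succ_le ((f i).smooth ⊤)
          (fun y => SchwartzMap.norm_iteratedFDeriv_le_seminorm ℝ (f i) n y)
          (fun y => (SchwartzMap.norm_iteratedFDeriv_le_seminorm ℝ (f i) (n + 2) y).trans
            (hi.trans (le_max_left _ _))) (by positivity) x
      have h3 : C' * (ε / (2 * C')) = ε / 2 := by field_simp
      rw [h3] at h2
      have h4 : 2 * SchwartzMap.seminorm ℝ 0 n (f i) / (ε / (2 * C')) =
          2 / (ε / (2 * C')) * SchwartzMap.seminorm ℝ 0 n (f i) := by ring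
      linarith
  have key2 : ∀ k n : ℕ, Tendsto (fun i => SchwartzMap.seminorm ℝ k n (f i)) l (𝓝 0) := by
    intro k n
    obtain ⟨C, hC⟩ := hb (2 * k) n
    have h1 : Tendsto (fun i => √(SchwartzMap.seminorm ℝ 0 n (f i) * C)) l (𝓝 0) := by
      simpa using ((key n).mul_const C).sqrt
    refine squeeze_zero' (Eventually.of_forall fun _ => apply_nonneg _ _) ?_ h1
    filter_upwards [hC] with i hi
    refine SchwartzMap.seminorm_le_bound ℝ k n (f i) (Real.sqrt_nonneg _) fun x => ?_
    refine Real.le_sqrt_of_sq_le ?_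
    have h2 := SchwartzMap.norm_iteratedFDeriv_le_seminorm ℝ (f i) n x
    have h3 := (SchwartzMap.le_seminorm ℝ (2 * k) n (f i) x).trans hi
    calc (‖x‖ ^ k * ‖iteratedFDeriv ℝ n (f i) x‖) ^ 2
        = ‖iteratedFDeriv ℝ n (f i) x‖ * (‖x‖ ^ (2 * k) * ‖iteratedFDeriv ℝ n (f i) x‖) := by
          ring
      _ ≤ _ := by gcongr
  rw [(schwartz_withSeminorms ℝ V F).tendsto_nhds]
  rintro ⟨k, n⟩ ε hε
  filter_upwards [(key2 k n).eventually (gt_mem_nhds hε)] with i hi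
  simpa [schwartzSeminormFamily] using hi

set_option maxSynthPendingDepth 3 in
/-- Bounds for the derivatives of a solution `γ` of the equation `γ x = c x + N (γ x)`, at
a point `x`, which only depend on bounds for the derivatives of `N` at `γ x` and for the inverse
of `1 - N'(γ x)`. -/
lemma exists_forall_norm_iteratedFDeriv_le (n : ℕ) {B R : ℝ} (hB : 0 ≤ B) (hR : 0 ≤ R) :
    ∃ C : ℝ, 1 ≤ C ∧ ∀ (c : V →L[ℝ] X) (N : X → X) (γ : V → X) (x : V), ‖c‖ ≤ 1 →
      ContDiff ℝ ∞ N → ContDiff ℝ ∞ γ → (∀ y, γ y = c y + N (γ y)) →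
      (∀ i, 1 ≤ i → i ≤ n → ‖iteratedFDeriv ℝ i N (γ x)‖ ≤ B) →
      (∀ y, ‖y‖ ≤ R * ‖y - fderiv ℝ N (γ x) y‖) →
      ∀ i, 1 ≤ i → i ≤ n → ‖iteratedFDeriv ℝ i γ x‖ ≤ C := by
  induction n with
  | zero => exact ⟨1, le_rfl, fun _ _ _ _ _ _ _ _ _ _ i h1 h2 => by omega⟩
  | succ n ih =>
    obtain ⟨C, hC1, hC⟩ := ih
    set S : ℝ := ∑ i ∈ Finset.range (n + 1),
      (n.choose i : ℝ) * (i.factorial * B * C ^ i) * C with hS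
    refine ⟨max C (R * (1 + S)), hC1.trans (le_max_left _ _), ?_⟩
    intro c N γ x hc hN hγ hfix hNB hinv i hi1 hi2
    have hIH := hC c N γ x hc hN hγ hfix (fun i h1 h2 => hNB i h1 (h2.trans n.le_succ)) hinv
    rcases hi2.lt_or_eq with h | rfl
    · exact (hIH i hi1 (Nat.lt_succ_iff.1 h)).trans (le_max_left _ _)
    refine le_trans ?_ (le_max_right _ _)
    rw [← norm_iteratedFDeriv_fderiv]
    set T := fderiv ℝ N (γ x) with hT
    set g := fderiv ℝ γ with hg
    have hgs : ContDiff ℝ ∞ g := hγ.fderiv_right (by simp)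
    have hNs : ContDiff ℝ ∞ (fderiv ℝ N) := hN.fderiv_right (by simp)
    set A : V → X →L[ℝ] X := fun y => fderiv ℝ N (γ y) with hA
    have hAs : ContDiff ℝ ∞ A := hNs.comp hγ
    set P := ContinuousLinearMap.compL ℝ V X X with hP
    have hPn : ‖P‖ ≤ 1 := ContinuousLinearMap.norm_compL_le ℝ V X X
    -- the linearised equation, with the coefficient frozen at `x` moved to the left
    have hlin : ∀ y, g y - P T (g y) = c + P (A y - T) (g y) := by
      intro y
      have h1 : HasFDerivAt γ (c + (A y).comp (g y)) y := by
        have h2 : HasFDerivAt (fun y => c y + N (γ y)) (c + (A y).comp (g y)) y :=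
          c.hasFDerivAt.add (((hN.differentiable (by simp)) (γ y)).hasFDerivAt.comp y
            ((hγ.differentiable (by simp)) y).hasFDerivAt)
        rwa [← funext hfix] at h2
      have h3 : g y = c + (A y).comp (g y) := h1.fderiv
      rw [map_sub, sub_apply]
      simp only [hP, ContinuousLinearMap.compL_apply]
      nth_rewrite 1 [h3]
      abel
    set L : (V →L[ℝ] X) →L[ℝ] (V →L[ℝ] X) := ContinuousLinearMap.id ℝ _ - P T with hL
    have hLinv : ∀ z, ‖z‖ ≤ R * ‖L z‖ := by
      intro z
      refine ContinuousLinearMap.opNorm_le_bound _ (by positivity) fun v => ?_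
      refine (hinv (z v)).trans ?_
      rw [mul_assoc]
      gcongr
      exact (L z).le_opNorm v
    have h1 : ‖iteratedFDeriv ℝ n g x‖ ≤ R * ‖iteratedFDeriv ℝ n (L ∘ g) x‖ := by
      refine ContinuousMultilinearMap.opNorm_le_bound (by positivity) fun m => ?_
      rw [L.iteratedFDeriv_comp_left hgs.contDiffAt (by exact_mod_cast le_top)]
      refine (hLinv _).trans ?_
      rw [mul_assoc]
      gcongr
      exact ContinuousMultilinearMap.le_opNorm
        (L.compContinuousMultilinearMap (iteratedFDeriv ℝ n g x)) m
    refine h1.trans (mul_le_mul_of_nonneg_left ?_ hR)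
    have hLg : L ∘ g = (fun _ => c) + fun y => P (A y - T) (g y) := funext fun y => hlin y
    have hAT : ContDiff ℝ ∞ (fun y => A y - T) := hAs.sub contDiff_const
    have hPs : ContDiff ℝ ∞ (fun y => P (A y - T) (g y)) :=
      (P.contDiff.comp hAT).clm_apply hgs
    rw [hLg, iteratedFDeriv_add_apply contDiff_const.contDiffAt
      (hPs.of_le (by exact_mod_cast le_top)).contDiffAt]
    refine (norm_add_le _ _).trans (add_le_add ?_ ?_)
    · rcases n with _ | n
      · rw [norm_iteratedFDeriv_zero]; exact hc
      · rw [iteratedFDeriv_const_of_ne (Nat.succ_ne_zero n)]; simp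
    refine (P.norm_iteratedFDeriv_le_of_bilinear_of_le_one hAT hgs x
      (by exact_mod_cast le_top) hPn).trans (Finset.sum_le_sum fun i hi => ?_)
    rw [Finset.mem_range, Nat.lt_succ_iff] at hi
    rcases i with _ | i
    -- the term of order zero drops out, because `A x = T`
    · have : A x - T = 0 := sub_self _
      rw [norm_iteratedFDeriv_zero, this]
      simp only [norm_zero, mul_zero, zero_mul]
      positivity
    have hsub : iteratedFDeriv ℝ (i + 1) (fun y => A y - T) x = iteratedFDeriv ℝ (i + 1) A x := by
      have : (fun y => A y - T) = A + fun _ => -T := by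
        ext1 y; simp [sub_eq_add_neg]
      rw [this, iteratedFDeriv_add_apply (hAs.of_le (by exact_mod_cast le_top)).contDiffAt
        contDiff_const.contDiffAt, iteratedFDeriv_const_of_ne (Nat.succ_ne_zero i)]
      simp
    have hDA : ‖iteratedFDeriv ℝ (i + 1) A x‖ ≤ (i + 1).factorial * B * C ^ (i + 1) := by
      refine norm_iteratedFDeriv_comp_le hNs hγ (by exact_mod_cast le_top) x (fun j hj => ?_)
        fun j hj1 hj2 => (hIH j hj1 (hj2.trans hi)).trans (le_self_pow₀ hC1 (by omega))
      rw [norm_iteratedFDeriv_fderiv]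
      exact hNB _ (by omega) (by omega)
    have hDg : ‖iteratedFDeriv ℝ (n - (i + 1)) g x‖ ≤ C := by
      rw [hg, norm_iteratedFDeriv_fderiv]
      exact hIH _ (by omega) (by omega)
    rw [hsub]
    gcongr

section Perturbation

open scoped NNReal

/-- `1 - N` approximates the identity, so that it is a homeomorphism by the inverse function theorem
on the whole space, and its derivatives are invertible by the Neumann series. -/
lemma exists_contDiff_inverse_of_lipschitzWith [CompleteSpace X] {N : X → X} (hN : ContDiff ℝ ∞ N)
    (hl : LipschitzWith (1 / 2 : ℝ≥0) N) :
    ∃ G : X → X, ContDiff ℝ ∞ G ∧ (∀ y, G y - N (G y) = y) ∧ ∀ a, G (a - N a) = a := by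
  have happ : ApproximatesLinearOn (fun a => a - N a)
      ((ContinuousLinearEquiv.refl ℝ X : X ≃L[ℝ] X) : X →L[ℝ] X) Set.univ (1 / 2 : ℝ≥0) := by
    intro a _ b _
    have := hl.dist_le_mul a b
    rw [dist_eq_norm, dist_eq_norm] at this
    refine le_trans (le_of_eq ?_) this
    rw [← norm_neg]
    congr 1
    simp only [ContinuousLinearEquiv.coe_refl, ContinuousLinearMap.coe_id', id_eq]
    abel
  have hc : Subsingleton X ∨ (1 / 2 : ℝ≥0) <
      ‖((ContinuousLinearEquiv.refl ℝ X).symm : X →L[ℝ] X)‖₊⁻¹ := by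
    rcases subsingleton_or_nontrivial X with h | h
    · exact Or.inl h
    · right
      have : ‖((ContinuousLinearEquiv.refl ℝ X).symm : X →L[ℝ] X)‖₊ = 1 :=
        NNReal.eq ContinuousLinearMap.norm_id
      rw [this, inv_one]
      exact NNReal.half_lt_self one_ne_zero
  let H : X ≃ₜ X := happ.toHomeomorph (fun a => a - N a) hc
  have hH : ∀ a, H a = a - N a := fun _ => rfl
  have hnorm : ∀ a, ‖fderiv ℝ N a‖ < 1 := fun a =>
    (((hN.differentiable (by simp)) a).hasFDerivAt.le_of_lipschitz hl).trans_lt (by norm_num)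
  have hder : ∀ a, HasFDerivAt H ((ContinuousLinearEquiv.unitsEquiv ℝ X
      (Units.oneSub _ (hnorm a)) : X ≃L[ℝ] X) : X →L[ℝ] X) a := by
    intro a
    have h1 : HasFDerivAt (fun a => a - N a) (ContinuousLinearMap.id ℝ X - fderiv ℝ N a) a :=
      (hasFDerivAt_id a).sub ((hN.differentiable (by simp)) a).hasFDerivAt
    exact h1
  refine ⟨H.symm, H.contDiff_symm hder (contDiff_id.sub hN), fun y => ?_, fun a => ?_⟩
  · rw [← hH, H.apply_symm_apply]
  · rw [← hH, H.symm_apply_apply]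

variable {N : X → X} {W : X ≃L[ℝ] X}

lemma lipschitzWith_conj (hl : ∀ a b, ‖W.symm (N a - N b)‖ ≤ 1 / 2 * ‖W.symm (a - b)‖) :
    LipschitzWith (1 / 2 : ℝ≥0) fun a => W.symm (N (W a)) := by
  refine LipschitzWith.of_dist_le_mul fun a b => ?_
  have := hl (W a) (W b)
  rw [dist_eq_norm, dist_eq_norm, ← map_sub]
  simpa using this

/-- If `N` is a contraction for the norm `a ↦ ‖W⁻¹ a‖`, then `a ↦ a - N a` is bijective
with smooth inverse. -/
lemma exists_contDiff_inverse [CompleteSpace X] (hN : ContDiff ℝ ∞ N)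
    (hl : ∀ a b, ‖W.symm (N a - N b)‖ ≤ 1 / 2 * ‖W.symm (a - b)‖) :
    ∃ G : X → X, ContDiff ℝ ∞ G ∧ (∀ y, G y - N (G y) = y) ∧ ∀ a, G (a - N a) = a := by
  obtain ⟨G, hG, hG1, hG2⟩ := exists_contDiff_inverse_of_lipschitzWith
    (N := fun a => W.symm (N (W a))) (W.symm.contDiff.comp (hN.comp W.contDiff))
    (lipschitzWith_conj hl)
  refine ⟨fun y => W (G (W.symm y)), W.contDiff.comp (hG.comp W.symm.contDiff), fun y => ?_,
    fun a => ?_⟩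
  · have := congrArg W (hG1 (W.symm y))
    simpa using this
  · have := congrArg W (hG2 (W.symm a))
    simpa using this

/-- In the weighted norm the derivative of `N` has norm at most `1 / 2`. -/
lemma norm_le_of_fderiv (hN : ContDiff ℝ ∞ N)
    (hl : ∀ a b, ‖W.symm (N a - N b)‖ ≤ 1 / 2 * ‖W.symm (a - b)‖) (a y : X) :
    ‖W.symm y‖ ≤ 2 * ‖W.symm (y - fderiv ℝ N a y)‖ := by
  have h1 : HasFDerivAt (fun a => W.symm (N (W a)))
      ((W.symm : X →L[ℝ] X) ∘L (fderiv ℝ N a ∘L (W : X →L[ℝ] X))) (W.symm a) := by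
    refine W.symm.hasFDerivAt.comp (W.symm a) (HasFDerivAt.comp _ ?_ W.hasFDerivAt)
    rw [W.apply_symm_apply]
    exact ((hN.differentiable (by simp)) a).hasFDerivAt
  have h2 := ContinuousLinearMap.le_of_opNorm_le _ (h1.le_of_lipschitz (lipschitzWith_conj hl))
    (W.symm y)
  simp only [ContinuousLinearMap.comp_apply, ContinuousLinearEquiv.coe_coe,
    ContinuousLinearEquiv.apply_symm_apply] at h2
  have h3 := norm_sub_norm_le (W.symm y) (W.symm (fderiv ℝ N a y))
  rw [← map_sub] at h3
  have h4 : (((1 / 2 : ℝ≥0) : ℝ)) = 1 / 2 := by norm_num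
  rw [h4] at h2
  linarith

end Perturbation

end Calculus

/-! ### Primitives and exponential weights -/

section Primitive

variable {F : Type*} [NormedAddCommGroup F] [NormedSpace ℝ F]

lemma continuous_setIntegral_Iic {f : I → F} (hf : Integrable f) :
    Continuous fun t : I => ∫ s in Set.Iic t, f s := by
  rw [continuous_iff_continuousAt]
  intro t
  have h : ∀ t : I, ∫ s in Set.Iic t, f s = ∫ s, (Set.Iic t).indicator f s :=
    fun t => (integral_indicator measurableSet_Iic).symm
  simp_rw [h]
  refine continuousAt_of_dominated (bound := fun s => ‖f s‖)
    (Eventually.of_forall fun t => hf.aestronglyMeasurable.indicator measurableSet_Iic)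
    (Eventually.of_forall fun t => ae_of_all _ fun s => norm_indicator_le_norm_self _ _)
    hf.norm ?_
  have hne : ∀ᵐ s : I, s ≠ t := by
    rw [ae_iff]
    simp
  filter_upwards [hne] with s hs
  rcases lt_or_gt_of_ne hs with h | h
  · have : (fun t : I => (Set.Iic t).indicator f s) =ᶠ[𝓝 t] fun _ => f s := by
      filter_upwards [lt_mem_nhds h] with r hr
      exact Set.indicator_of_mem (Set.mem_Iic.2 hr.le) _
    exact continuousAt_const.congr this.symm
  · have : (fun t : I => (Set.Iic t).indicator f s) =ᶠ[𝓝 t] fun _ => 0 := by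
      filter_upwards [gt_mem_nhds h] with r hr
      exact Set.indicator_of_notMem (by simpa using hr) _
    exact continuousAt_const.congr this.symm

/-- The primitive `t ↦ ∫₀ᵗ f` of an integrable curve, as an operator `L¹ → C(I, F)`. -/
def primitive : Lp F 1 (volume : Measure I) →L[ℝ] C(I, F) :=
  LinearMap.mkContinuous
    { toFun := fun f => ⟨fun t => ∫ s in Set.Iic t, f s,
        continuous_setIntegral_Iic (L1.integrable_coeFn f)⟩
      map_add' := fun f g => by
        ext t
        simp only [ContinuousMap.coe_mk, ContinuousMap.add_apply]
        rw [← integral_add (L1.integrable_coeFn f).integrableOn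
          (L1.integrable_coeFn g).integrableOn]
        exact integral_congr_ae (ae_restrict_of_ae (Lp.coeFn_add f g))
      map_smul' := fun c f => by
        ext t
        simp only [ContinuousMap.coe_mk, RingHom.id_apply, ContinuousMap.smul_apply]
        rw [← integral_smul]
        exact integral_congr_ae (ae_restrict_of_ae (Lp.coeFn_smul c f)) }
    1 fun f => by
      rw [one_mul, ContinuousMap.norm_le _ (norm_nonneg _)]
      intro t
      refine (norm_integral_le_integral_norm _).trans ?_
      rw [L1.norm_eq_integral_norm]
      exact setIntegral_le_integral (L1.integrable_coeFn f).norm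
        (ae_of_all _ fun _ => norm_nonneg _)

lemma primitive_apply (f : Lp F 1 (volume : Measure I)) (t : I) :
    primitive f t = ∫ s in Set.Iic t, f s := rfl

lemma norm_primitive_le : ‖(primitive : Lp F 1 (volume : Measure I) →L[ℝ] C(I, F))‖ ≤ 1 :=
  LinearMap.mkContinuous_norm_le _ zero_le_one _

lemma setIntegral_Iic_sub {f : I → F} (hf : Integrable f) {s t : I} (hst : s ≤ t) :
    (∫ r in Set.Iic t, f r) - ∫ r in Set.Iic s, f r = ∫ r in Set.Ioc s t, f r := by
  rw [← Set.Iic_union_Ioc_eq_Iic hst, setIntegral_union (Set.Iic_disjoint_Ioc le_rfl)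
    measurableSet_Ioc hf.integrableOn hf.integrableOn]
  abel

end Primitive

section Weight

variable {m : I → ℝ}

/-- The weight `t ↦ exp (4 ∫₀ᵗ m)` for an integrable function `m`. The factor `4` makes a Volterra
operator with kernel bounded by `m` a contraction with constant `1 / 2` for the weighted
supremum norm. -/
def expWeight (hm : Integrable m) : C(I, ℝ) :=
  ⟨fun t => Real.exp (4 * ∫ s in Set.Iic t, m s),
    Real.continuous_exp.comp (continuous_const.mul (continuous_setIntegral_Iic hm))⟩

lemma integrable_mul_continuous (hm : Integrable m) (w : C(I, ℝ)) :
    Integrable fun s => m s * w s :=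
  hm.mul_bdd w.continuous.aestronglyMeasurable (c := ‖w‖)
    (ae_of_all _ fun s => w.norm_coe_le_norm s)

lemma setIntegral_Iic_mono {f : I → ℝ} (hf : Integrable f) (hf0 : ∀ s, 0 ≤ f s) :
    Monotone fun t : I => ∫ s in Set.Iic t, f s := fun _ _ hst =>
  setIntegral_mono_set hf.integrableOn (ae_of_all _ hf0)
    (LE.le.eventuallyLE (Set.Iic_subset_Iic.2 hst))

/-- The exponential weight is a supersolution of `w' = 2 m w`, in integrated form. As `m` is
only integrable, this is proved by continuous induction on `t`, comparing the increments on short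
intervals, instead of by the chain rule. -/
lemma setIntegral_mul_expWeight_le (hm : Integrable m) (hm0 : ∀ s, 0 ≤ m s) (t : I) :
    ∫ s in Set.Iic t, m s * expWeight hm s ≤ 1 / 2 * expWeight hm t := by
  set w := expWeight hm with hw
  set M : I → ℝ := fun t => ∫ s in Set.Iic t, m s with hM
  have hMc : Continuous M := continuous_setIntegral_Iic hm
  have hMm : Monotone M := setIntegral_Iic_mono hm hm0
  have hwM : ∀ t, w t = Real.exp (4 * M t) := fun t => rfl
  have hmw := integrable_mul_continuous hm w
  set H : I → ℝ := fun t => ∫ s in Set.Iic t, m s * w s with hH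
  have hHc : Continuous H := continuous_setIntegral_Iic hmw
  change t ∈ {t | H t ≤ 1 / 2 * w t}
  refine IsClosed.mem_of_ge_of_forall_exists_gt (a := 0) ?_ ?_ t.2.1 ?_
  · exact (isClosed_le hHc (continuous_const.mul w.continuous)).inter isClosed_Icc
  · have h0 : H 0 = 0 := by
      have : (Set.Iic (0 : I)) = {0} := by
        ext s
        exact ⟨fun h => le_antisymm h s.2.1, fun h => h.le⟩
      simp [hH, this]
    change H 0 ≤ _
    rw [h0, hwM]
    positivity
  rintro x ⟨hx, -, hxt⟩
  have hnear : ∀ᶠ z in 𝓝[>] x, M z < M x + 1 / 4 :=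
    nhdsWithin_le_nhds (hMc.continuousAt.eventually (gt_mem_nhds (by linarith)))
  have hIoc : ∀ᶠ z in 𝓝[>] x, z ∈ Set.Ioc x t := Ioc_mem_nhdsGT hxt
  have : (𝓝[>] x).NeBot := nhdsGT_neBot_of_exists_gt ⟨t, hxt⟩
  obtain ⟨z, hz, hzI⟩ := (hnear.and hIoc).exists
  refine ⟨z, ?_, hzI⟩
  have hxz : x ≤ z := hzI.1.le
  have hΔ0 : 0 ≤ M z - M x := sub_nonneg.2 (hMm hxz)
  have h1 : H z - H x ≤ (M z - M x) * w z := by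
    rw [hH, hM]
    simp only
    rw [setIntegral_Iic_sub hmw hxz, setIntegral_Iic_sub hm hxz, ← integral_mul_const]
    refine setIntegral_mono_on hmw.integrableOn (hm.mul_const _).integrableOn
      measurableSet_Ioc fun s hs => ?_
    refine mul_le_mul_of_nonneg_left ?_ (hm0 s)
    rw [hwM, hwM]
    exact Real.exp_le_exp.2 (by linarith [hMm hs.2])
  have h2 : w x ≤ (1 - 2 * (M z - M x)) * w z := by
    have h3 : w x = Real.exp (-(4 * (M z - M x))) * w z := by
      rw [hwM, hwM, ← Real.exp_add]; congr 1; ring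
    rw [h3]
    refine mul_le_mul_of_nonneg_right ?_ (Real.exp_pos _).le
    rw [Real.exp_neg]
    refine inv_le_of_inv_le₀ (by linarith) (le_trans ?_ (Real.add_one_le_exp _))
    rw [inv_le_iff_one_le_mul₀ (by linarith)]
    nlinarith
  change H z ≤ _
  have hx' : H x ≤ 1 / 2 * w x := hx
  linarith

lemma one_le_expWeight (hm : Integrable m) (hm0 : ∀ s, 0 ≤ m s) (t : I) : 1 ≤ expWeight hm t :=
  Real.one_le_exp (mul_nonneg (by norm_num) (integral_nonneg hm0))

lemma expWeight_le (hm : Integrable m) (hm0 : ∀ s, 0 ≤ m s) (t : I) :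
    expWeight hm t ≤ Real.exp (4 * ∫ s, m s) :=
  Real.exp_le_exp.2 (mul_le_mul_of_nonneg_left
    (setIntegral_le_integral hm (ae_of_all _ hm0)) (by norm_num))

variable {V : Type*} [NormedAddCommGroup V] [NormedSpace ℝ V]

/-- Multiplication by a continuous function, as an operator on `C(I, V)`. -/
def smulCLM (w : C(I, ℝ)) : C(I, V) →L[ℝ] C(I, V) :=
  LinearMap.mkContinuous
    { toFun := fun γ => ⟨fun t => w t • γ t, w.continuous.smul γ.continuous⟩
      map_add' := fun γ δ => by ext t; simp
      map_smul' := fun c γ => by ext t; simp [smul_comm (w t) c] }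
    ‖w‖ fun γ => by
      rw [ContinuousMap.norm_le _ (by positivity)]
      intro t
      change ‖w t • γ t‖ ≤ _
      rw [norm_smul]
      exact mul_le_mul (w.norm_coe_le_norm t) (γ.norm_coe_le_norm t) (norm_nonneg _)
        (norm_nonneg _)

/-- Multiplication by the exponential weight, as an automorphism of `C(I, V)`. -/
def expWeightEquiv (hm : Integrable m) : C(I, V) ≃L[ℝ] C(I, V) :=
  ContinuousLinearEquiv.equivOfInverse (smulCLM (expWeight hm))
    (smulCLM ⟨fun t => (expWeight hm t)⁻¹,
      (expWeight hm).continuous.inv₀ fun t => (Real.exp_pos _).ne'⟩)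
    (fun γ => by
      ext t
      exact inv_smul_smul₀ (Real.exp_pos _).ne' _)
    (fun γ => by
      ext t
      exact smul_inv_smul₀ (Real.exp_pos _).ne' _)

lemma expWeightEquiv_symm_apply (hm : Integrable m) (γ : C(I, V)) (t : I) :
    (expWeightEquiv hm).symm γ t = (expWeight hm t)⁻¹ • γ t := rfl

lemma norm_expWeightEquiv_symm_le (hm : Integrable m) (hm0 : ∀ s, 0 ≤ m s) (γ : C(I, V)) :
    ‖(expWeightEquiv hm).symm γ‖ ≤ ‖γ‖ := by
  rw [ContinuousMap.norm_le _ (norm_nonneg _)]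
  intro t
  rw [expWeightEquiv_symm_apply, norm_smul, norm_inv,
    Real.norm_of_nonneg (zero_le_one.trans (one_le_expWeight hm hm0 t))]
  calc (expWeight hm t)⁻¹ * ‖γ t‖ ≤ 1 * ‖γ‖ := by
        gcongr
        · exact inv_le_one_of_one_le₀ (one_le_expWeight hm hm0 t)
        · exact γ.norm_coe_le_norm t
    _ = ‖γ‖ := one_mul _

lemma norm_apply_le_expWeight_mul (hm : Integrable m) (γ : C(I, V)) (t : I) :
    ‖γ t‖ ≤ expWeight hm t * ‖(expWeightEquiv hm).symm γ‖ := by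
  have h := ((expWeightEquiv hm).symm γ).norm_coe_le_norm t
  have h0 : 0 < expWeight hm t := Real.exp_pos _
  rwa [expWeightEquiv_symm_apply, norm_smul, norm_inv, Real.norm_of_nonneg h0.le,
    inv_mul_le_iff₀ h0] at h

lemma norm_le_exp_mul_norm_expWeightEquiv_symm (hm : Integrable m) (hm0 : ∀ s, 0 ≤ m s)
    (γ : C(I, V)) :
    ‖γ‖ ≤ Real.exp (4 * ∫ s, m s) * ‖(expWeightEquiv hm).symm γ‖ := by
  rw [ContinuousMap.norm_le _ (by positivity)]
  intro t
  refine (norm_apply_le_expWeight_mul hm γ t).trans ?_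
  gcongr
  exact expWeight_le hm hm0 t

end Weight

/-! ### Curves in the Schwartz space and their superposition operators -/

section Superposition

set_option maxSynthPendingDepth 3

/-- A curve in a locally convex space which is measurable by seminorm and has integrable seminorms.
In contrast to integrability by seminorm, the existence of integrals in the space is
not required. -/
structure IsL1Curve {E : Type*} [AddCommGroup E] [Module ℝ E] [TopologicalSpace E]
    (g : I → E) : Prop where
  measurable : MeasurableBySeminorm g
  integrable : ∀ p : Seminorm ℝ E, Continuous p → Integrable fun t => p (g t)

lemma IsL1Curve.comp {E E' : Type*} [AddCommGroup E] [Module ℝ E] [TopologicalSpace E]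
    [AddCommGroup E'] [Module ℝ E'] [TopologicalSpace E'] {g : I → E} (hg : IsL1Curve g)
    (T : E →L[ℝ] E') : IsL1Curve fun t => T (g t) := by
  have hT : ∀ p : Seminorm ℝ E', Continuous p → Continuous (p.comp T.toLinearMap) :=
    fun p hp => hp.comp T.continuous
  obtain ⟨a, ha⟩ := hg.measurable
  refine ⟨⟨fun p n t => T (a (p.comp T.toLinearMap) n t), fun p hp n =>
    (ha.simple _ (hT p hp) n).comp T, fun p hp => ?_⟩, fun p hp => hg.integrable _ (hT p hp)⟩
  filter_upwards [ha.tendsto _ (hT p hp)] with t ht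
  refine ht.congr fun n => ?_
  rw [Seminorm.comp_apply]
  exact congrArg p (map_sub T _ _)

lemma PreL1.isL1Curve {E : Type*} [AddCommGroup E] [Module ℝ E] [TopologicalSpace E]
    (u : PreL1 E) : IsL1Curve fun t => u t := by
  obtain ⟨a, ha, -⟩ := u.2
  exact ⟨⟨a, ha⟩, fun p hp => u.integrable_seminorm p hp⟩

universe v

-- `V` and `F` live in one universe, as the inductions on the order of the derivative below
-- replace `F` by `V →L[ℝ] F`.
variable {V F : Type v} [NormedAddCommGroup V] [NormedSpace ℝ V] [NormedAddCommGroup F]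
  [NormedSpace ℝ F] {g : I → 𝓢(V, F)}

lemma continuous_seminorm (k n : ℕ) :
    Continuous (SchwartzMap.seminorm ℝ k n : Seminorm ℝ 𝓢(V, F)) :=
  (schwartz_withSeminorms ℝ V F).continuous_seminorm (k, n)

lemma IsL1Curve.integrable_seminorm (hg : IsL1Curve g) (k n : ℕ) :
    Integrable fun t => SchwartzMap.seminorm ℝ k n (g t) :=
  hg.integrable _ (continuous_seminorm k n)

lemma IsSimple.aestronglyMeasurable_apply {h : I → 𝓢(V, F)} (hh : IsSimple h) (γ : C(I, V)) :
    AEStronglyMeasurable (fun s => h s (γ s)) (volume : Measure I) := by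
  classical
  have : (fun s => h s (γ s)) = fun s => ∑ y ∈ hh.finite_range.toFinset,
      (h ⁻¹' {y}).indicator (fun s => y (γ s)) s := by
    ext1 s
    rw [Finset.sum_eq_single (h s)]
    · exact (Set.indicator_of_mem (s := h ⁻¹' {h s}) (Set.mem_singleton (h s))
        fun s' => h s (γ s')).symm
    · intro y _ hy
      exact Set.indicator_of_notMem (s := h ⁻¹' {y})
        (fun hs => hy (Set.mem_singleton_iff.1 hs).symm) _
    · intro hs
      exact absurd (hh.finite_range.mem_toFinset.2 ⟨s, rfl⟩) hs
  rw [this]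
  exact Finset.aestronglyMeasurable_fun_sum _ fun y _ =>
    AEStronglyMeasurable.indicator₀
      (y.continuous.comp γ.continuous).aestronglyMeasurable (hh.measurable_fiber y)

lemma IsL1Curve.integrable_apply (hg : IsL1Curve g) (γ : C(I, V)) :
    Integrable fun s => g s (γ s) := by
  refine (hg.integrable_seminorm 0 0).mono' ?_
    (ae_of_all _ fun s => SchwartzMap.norm_le_seminorm ℝ _ _)
  obtain ⟨a, ha⟩ := hg.measurable
  refine aestronglyMeasurable_of_tendsto_ae atTop
    (fun n => (ha.simple _ (continuous_seminorm 0 0) n).aestronglyMeasurable_apply γ) ?_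
  filter_upwards [ha.tendsto _ (continuous_seminorm 0 0)] with s hs
  rw [tendsto_iff_norm_sub_tendsto_zero]
  refine squeeze_zero (fun _ => norm_nonneg _) (fun n => ?_) hs
  exact SchwartzMap.norm_le_seminorm ℝ (a _ n s - g s) (γ s)

/-- The superposition (Nemytskii) operator `γ ↦ (s ↦ g s (γ s))`, from `C(I, V)` to `L¹(I, F)`. -/
def superposition (hg : IsL1Curve g) (γ : C(I, V)) : Lp F 1 (volume : Measure I) :=
  (hg.integrable_apply γ).toL1 _

lemma coeFn_superposition (hg : IsL1Curve g) (γ : C(I, V)) :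
    superposition hg γ =ᵐ[volume] fun s => g s (γ s) :=
  Integrable.coeFn_toL1 _

lemma norm_le_integral_of_ae_le {F : Type*} [NormedAddCommGroup F]
    {f : Lp F 1 (volume : Measure I)} {b : I → ℝ}
    (hb : Integrable b) (hfb : ∀ᵐ s, ‖f s‖ ≤ b s) : ‖f‖ ≤ ∫ s, b s := by
  rw [L1.norm_eq_integral_norm]
  exact integral_mono_ae (L1.integrable_coeFn f).norm hb hfb

variable (V F) in
/-- The pointwise action of `L¹(I, V →L F)` on `C(I, V)`, with values in `L¹(I, F)`. -/
def pointwiseAction : Lp (V →L[ℝ] F) 1 (volume : Measure I) →L[ℝ] C(I, V) →L[ℝ]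
    Lp F 1 (volume : Measure I) :=
  ((ContinuousLinearMap.id ℝ (V →L[ℝ] F)).holderL (volume : Measure I) 1 ⊤ 1).bilinearComp
    (ContinuousLinearMap.id ℝ _) (ContinuousMap.toLp ⊤ (volume : Measure I) ℝ)

lemma coeFn_pointwiseAction (A : Lp (V →L[ℝ] F) 1 (volume : Measure I)) (h : C(I, V)) :
    pointwiseAction V F A h =ᵐ[volume] fun s => A s (h s) := by
  filter_upwards [ContinuousLinearMap.coeFn_holder (r := 1) (ContinuousLinearMap.id ℝ (V →L[ℝ] F))
    A (ContinuousMap.toLp ⊤ (volume : Measure I) ℝ h),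
    ContinuousMap.coeFn_toLp (p := ⊤) (𝕜 := ℝ) (volume : Measure I) h] with s h1 h2
  rw [h2] at h1
  exact h1

lemma norm_pointwiseAction_le : ‖pointwiseAction V F‖ ≤ 1 := by
  refine ContinuousLinearMap.opNorm_le_bound₂ _ zero_le_one fun A h => ?_
  rw [one_mul, L1.norm_eq_integral_norm A, ← integral_mul_const]
  refine norm_le_integral_of_ae_le ((L1.integrable_coeFn A).norm.mul_const _) ?_
  filter_upwards [coeFn_pointwiseAction A h] with s hs
  rw [hs]
  refine ((A s).le_opNorm _).trans ?_
  gcongr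
  exact h.norm_coe_le_norm s

lemma IsL1Curve.fderiv (hg : IsL1Curve g) :
    IsL1Curve fun s => SchwartzMap.fderivCLM ℝ V F (g s) :=
  hg.comp (SchwartzMap.fderivCLM ℝ V F)

/-- The remainder is quadratic in the increment, as `s ↦ sup ‖D²(g s)‖` is integrable. -/
lemma hasFDerivAt_superposition (hg : IsL1Curve g) (γ : C(I, V)) :
    HasFDerivAt (superposition hg) (pointwiseAction V F (superposition hg.fderiv γ)) γ := by
  rw [hasFDerivAt_iff_isLittleO_nhds_zero]
  set C := ∫ s, SchwartzMap.seminorm ℝ 0 2 (g s) with hC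
  have hbound : ∀ h : C(I, V), ‖superposition hg (γ + h) - superposition hg γ -
      pointwiseAction V F (superposition hg.fderiv γ) h‖ ≤ C * ‖‖h‖ ^ 2‖ := by
    intro h
    rw [hC, ← integral_mul_const]
    refine norm_le_integral_of_ae_le ((hg.integrable_seminorm 0 2).mul_const _) ?_
    filter_upwards [Lp.coeFn_sub (superposition hg (γ + h) - superposition hg γ)
      (pointwiseAction V F (superposition hg.fderiv γ) h),
      Lp.coeFn_sub (superposition hg (γ + h)) (superposition hg γ),
      coeFn_superposition hg (γ + h), coeFn_superposition hg γ,
      coeFn_pointwiseAction (superposition hg.fderiv γ) h,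
      coeFn_superposition hg.fderiv γ] with s h1 h2 h3 h4 h5 h6
    rw [h1, Pi.sub_apply, h2, Pi.sub_apply, h3, h4, h5, h6, SchwartzMap.fderivCLM_apply]
    refine (norm_image_add_sub_sub_fderiv_le (g s).differentiable
      (norm_fderiv_sub_le ((g s).smooth ⊤) fun x =>
        SchwartzMap.norm_iteratedFDeriv_le_seminorm ℝ (g s) 2 x)
      (apply_nonneg _ _) (γ s) (h s)).trans ?_
    rw [norm_pow, norm_norm, mul_assoc, pow_two]
    have := h.norm_coe_le_norm s
    gcongr
  refine (Asymptotics.IsBigO.of_bound C (Eventually.of_forall hbound)).trans_isLittleO ?_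
  exact (Asymptotics.isLittleO_norm_pow_id one_lt_two)

lemma fderiv_superposition (hg : IsL1Curve g) :
    _root_.fderiv ℝ (superposition hg) = pointwiseAction V F ∘ superposition hg.fderiv :=
  funext fun γ => (hasFDerivAt_superposition hg γ).fderiv

lemma contDiff_superposition (hg : IsL1Curve g) : ContDiff ℝ ∞ (superposition hg) := by
  rw [contDiff_infty]
  intro n
  induction n generalizing F with
  | zero =>
    rw [Nat.cast_zero, contDiff_zero, continuous_iff_continuousAt]
    exact fun γ => (hasFDerivAt_superposition hg γ).continuousAt
  | succ n ih =>
    exact contDiff_succ_iff_hasFDerivAt.2 ⟨_, (pointwiseAction V F).contDiff.comp (ih hg.fderiv),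
      hasFDerivAt_superposition hg⟩

lemma norm_iteratedFDeriv_superposition_le (n : ℕ) (hg : IsL1Curve g) (γ : C(I, V)) {b : I → ℝ}
    (hb : Integrable b) (hgb : ∀ s, ‖iteratedFDeriv ℝ n (g s) (γ s)‖ ≤ b s) :
    ‖iteratedFDeriv ℝ n (superposition hg) γ‖ ≤ ∫ s, b s := by
  induction n generalizing F with
  | zero =>
    rw [norm_iteratedFDeriv_zero]
    refine norm_le_integral_of_ae_le hb ?_
    filter_upwards [coeFn_superposition hg γ] with s hs
    rw [hs, ← norm_iteratedFDeriv_zero (𝕜 := ℝ) (f := g s)]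
    exact hgb s
  | succ n ih =>
    rw [← norm_iteratedFDeriv_fderiv, fderiv_superposition]
    refine ((pointwiseAction V F).norm_iteratedFDeriv_comp_left
      (contDiff_superposition hg.fderiv).contDiffAt (by exact_mod_cast le_top)).trans ?_
    refine (mul_le_of_le_one_left (norm_nonneg _) norm_pointwiseAction_le).trans
      (ih hg.fderiv fun s => ?_)
    have : ⇑(SchwartzMap.fderivCLM ℝ V F (g s)) = _root_.fderiv ℝ (g s) :=
      funext fun x => SchwartzMap.fderivCLM_apply ℝ (g s) x
    rw [this, norm_iteratedFDeriv_fderiv]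
    exact hgb s

end Superposition

/-! ### The flow as a Schwartz function -/

section Flow

set_option maxSynthPendingDepth 3

universe v

variable {V : Type v} [NormedAddCommGroup V] [NormedSpace ℝ V] {u : I → 𝓢(V, V)}

/-- The integral operator `γ ↦ (t ↦ ∫₀ᵗ u s (γ s) ds)` on `C(I, V)`. -/
def integralOperator (hu : IsL1Curve u) (γ : C(I, V)) : C(I, V) :=
  primitive (superposition hu γ)

lemma integralOperator_apply (hu : IsL1Curve u) (γ : C(I, V)) (t : I) :
    integralOperator hu γ t = ∫ s in Set.Iic t, u s (γ s) := by
  rw [integralOperator, primitive_apply]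
  exact integral_congr_ae (ae_restrict_of_ae (coeFn_superposition hu γ))

lemma contDiff_integralOperator (hu : IsL1Curve u) : ContDiff ℝ ∞ (integralOperator hu) :=
  (primitive (F := V)).contDiff.comp (contDiff_superposition hu)

lemma norm_iteratedFDeriv_integralOperator_le (n : ℕ) (hu : IsL1Curve u) (γ : C(I, V)) {b : I → ℝ}
    (hb : Integrable b) (hub : ∀ s, ‖iteratedFDeriv ℝ n (u s) (γ s)‖ ≤ b s) :
    ‖iteratedFDeriv ℝ n (integralOperator hu) γ‖ ≤ ∫ s, b s :=
  ((primitive (F := V)).norm_iteratedFDeriv_comp_left (contDiff_superposition hu).contDiffAt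
    (by exact_mod_cast le_top)).trans
    ((mul_le_of_le_one_left (norm_nonneg _) norm_primitive_le).trans
      (norm_iteratedFDeriv_superposition_le n hu γ hb hub))

/-- Multiplication by the exponential weight for the Lipschitz constants of `u s`, which are bounded
by an integrable function of `s`. -/
abbrev lipschitzWeight (hu : IsL1Curve u) : C(I, V) ≃L[ℝ] C(I, V) :=
  expWeightEquiv (hu.integrable_seminorm 0 1)

/-- The integral operator is a contraction for the weighted supremum norm. -/
lemma norm_lipschitzWeight_symm_sub_le (hu : IsL1Curve u) (γ δ : C(I, V)) :
    ‖(lipschitzWeight hu).symm (integralOperator hu γ - integralOperator hu δ)‖ ≤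
      1 / 2 * ‖(lipschitzWeight hu).symm (γ - δ)‖ := by
  have hm := hu.integrable_seminorm 0 1
  have hm0 : ∀ s, 0 ≤ SchwartzMap.seminorm ℝ 0 1 (u s) := fun s => apply_nonneg _ _
  set S := ‖(lipschitzWeight hu).symm (γ - δ)‖ with hS
  rw [ContinuousMap.norm_le _ (by positivity)]
  intro t
  have h0 : 0 < expWeight hm t := Real.exp_pos _
  rw [expWeightEquiv_symm_apply, norm_smul, norm_inv, Real.norm_of_nonneg h0.le,
    inv_mul_le_iff₀ h0, ContinuousMap.sub_apply, integralOperator_apply, integralOperator_apply,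
    ← integral_sub (hu.integrable_apply γ).integrableOn (hu.integrable_apply δ).integrableOn]
  have hint : Integrable fun s => SchwartzMap.seminorm ℝ 0 1 (u s) * expWeight hm s * S :=
    (integrable_mul_continuous hm _).mul_const S
  refine (norm_integral_le_of_norm_le hint.integrableOn (ae_of_all _ fun s => ?_)).trans
    (le_of_le_of_eq (b := 1 / 2 * expWeight hm t * S) ?_ (by ring))
  · have h1 : ‖u s (γ s) - u s (δ s)‖ ≤ SchwartzMap.seminorm ℝ 0 1 (u s) * ‖γ s - δ s‖ := by
      refine Convex.norm_image_sub_le_of_norm_fderiv_le (𝕜 := ℝ) (s := Set.univ)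
        (fun z _ => (u s).differentiableAt) (fun z _ => ?_) convex_univ trivial trivial
      rw [← norm_iteratedFDeriv_one]
      exact SchwartzMap.norm_iteratedFDeriv_le_seminorm ℝ (u s) 1 z
    refine h1.trans ?_
    rw [mul_assoc]
    exact mul_le_mul_of_nonneg_left (norm_apply_le_expWeight_mul hm (γ - δ) s) (hm0 s)
  · rw [integral_mul_const]
    exact mul_le_mul_of_nonneg_right (setIntegral_mul_expWeight_le hm hm0 t) (norm_nonneg _)

variable (V) in
/-- The inclusion of the constant curves. -/
def constCurve : V →L[ℝ] C(I, V) := ContinuousLinearMap.const ℝ I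

@[simp]
lemma constCurve_apply (x : V) (t : I) : constCurve V x t = x := rfl

lemma norm_constCurve_le : ‖constCurve V‖ ≤ 1 := by
  refine ContinuousLinearMap.opNorm_le_bound _ zero_le_one fun x => ?_
  rw [one_mul, ContinuousMap.norm_le _ (norm_nonneg _)]
  exact fun t => le_rfl

lemma exists_bound_integral_seminorm (u : I → 𝓢(V, V)) (k n : ℕ) :
    ∃ B : ℝ, 0 ≤ B ∧ ∀ i ≤ k, ∀ j ≤ n, ∫ s, SchwartzMap.seminorm ℝ i j (u s) ≤ B := by
  have h0 : ∀ i j, 0 ≤ ∫ s, SchwartzMap.seminorm ℝ i j (u s) :=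
    fun i j => integral_nonneg fun _ => apply_nonneg _ _
  refine ⟨∑ i ∈ Finset.range (k + 1), ∑ j ∈ Finset.range (n + 1),
    ∫ s, SchwartzMap.seminorm ℝ i j (u s),
    Finset.sum_nonneg fun i _ => Finset.sum_nonneg fun j _ => h0 i j, fun i hi j hj => ?_⟩
  refine le_trans ?_ (Finset.single_le_sum
    (f := fun i => ∑ j ∈ Finset.range (n + 1), ∫ s, SchwartzMap.seminorm ℝ i j (u s))
    (fun i _ => Finset.sum_nonneg fun j _ => h0 i j) (Finset.mem_range.2 (Nat.lt_succ_of_le hi)))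
  exact Finset.single_le_sum (f := fun j => ∫ s, SchwartzMap.seminorm ℝ i j (u s))
    (fun j _ => h0 i j) (Finset.mem_range.2 (Nat.lt_succ_of_le hj))

variable [CompleteSpace V]

/-- The trajectory of `x` under the flow of `u`. It is obtained by applying the inverse
of `1 - integralOperator` to the constant curve `x`. -/
def trajectory (hu : IsL1Curve u) (x : V) : C(I, V) :=
  (exists_contDiff_inverse (contDiff_integralOperator hu)
    (norm_lipschitzWeight_symm_sub_le hu)).choose (constCurve V x)

lemma contDiff_trajectory (hu : IsL1Curve u) : ContDiff ℝ ∞ (trajectory hu) :=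
  (exists_contDiff_inverse (contDiff_integralOperator hu)
    (norm_lipschitzWeight_symm_sub_le hu)).choose_spec.1.comp (constCurve V).contDiff

lemma trajectory_eq (hu : IsL1Curve u) (x : V) :
    trajectory hu x = constCurve V x + integralOperator hu (trajectory hu x) :=
  sub_eq_iff_eq_add.1 ((exists_contDiff_inverse (contDiff_integralOperator hu)
    (norm_lipschitzWeight_symm_sub_le hu)).choose_spec.2.1 (constCurve V x))

lemma eq_trajectory (hu : IsL1Curve u) {x : V} {γ : C(I, V)}
    (hγ : γ = constCurve V x + integralOperator hu γ) : γ = trajectory hu x := by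
  rw [trajectory, ← sub_eq_iff_eq_add.2 hγ]
  exact ((exists_contDiff_inverse (contDiff_integralOperator hu)
    (norm_lipschitzWeight_symm_sub_le hu)).choose_spec.2.2 γ).symm

lemma isFlow_trajectory (hu : IsL1Curve u) :
    IsFlow (fun t => ⇑(u t)) fun t x => trajectory hu x t where
  continuous x := (trajectory hu x).continuous
  integrable x := hu.integrable_apply (trajectory hu x)
  eq_integral t x := by
    rw [← integralOperator_apply hu]
    exact congrArg (fun γ : C(I, V) => γ t) (trajectory_eq hu x)

lemma IsFlow.eq_trajectory (hu : IsL1Curve u) {Φ : I → V → V}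
    (hΦ : IsFlow (fun t => ⇑(u t)) Φ) : Φ = fun t x => trajectory hu x t := by
  ext t x
  have h := SeminormIntegral.eq_trajectory hu (x := x) (γ := ⟨fun t => Φ t x, hΦ.continuous x⟩) (by
    ext t
    rw [ContinuousMap.add_apply, integralOperator_apply, constCurve_apply]
    exact hΦ.eq_integral t x)
  exact congrArg (fun γ : C(I, V) => γ t) h

lemma norm_trajectory_sub_le (hu : IsL1Curve u) (x : V) (t : I) :
    ‖trajectory hu x t - x‖ ≤ ∫ s, SchwartzMap.seminorm ℝ 0 0 (u s) := by
  have h : trajectory hu x t - x = integralOperator hu (trajectory hu x) t := by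
    conv_lhs => rw [trajectory_eq hu x]
    simp
  rw [h]
  refine ((integralOperator hu (trajectory hu x)).norm_coe_le_norm t).trans ?_
  rw [← norm_iteratedFDeriv_zero (𝕜 := ℝ) (f := integralOperator hu)]
  exact norm_iteratedFDeriv_integralOperator_le 0 hu _ (hu.integrable_seminorm 0 0)
    fun s => SchwartzMap.norm_iteratedFDeriv_le_seminorm ℝ (u s) 0 _

/-- As a trajectory stays at bounded distance from its starting point, the decay of `u` passes to
the derivatives of the integral operator. -/
lemma norm_pow_mul_norm_iteratedFDeriv_integralOperator_le (hu : IsL1Curve u) (k n : ℕ) (x : V) :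
    ‖x‖ ^ k * ‖iteratedFDeriv ℝ n (integralOperator hu) (trajectory hu x)‖ ≤
      2 ^ (k - 1) * ((∫ s, SchwartzMap.seminorm ℝ k n (u s)) +
        (∫ s, SchwartzMap.seminorm ℝ 0 0 (u s)) ^ k * ∫ s, SchwartzMap.seminorm ℝ 0 n (u s)) := by
  set r := ∫ s, SchwartzMap.seminorm ℝ 0 0 (u s) with hr
  have hr0 : 0 ≤ r := integral_nonneg fun _ => apply_nonneg _ _
  set b : I → ℝ := fun s => 2 ^ (k - 1) * (SchwartzMap.seminorm ℝ k n (u s) +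
    r ^ k * SchwartzMap.seminorm ℝ 0 n (u s)) with hb
  have hbi : Integrable b := ((hu.integrable_seminorm k n).add
    ((hu.integrable_seminorm 0 n).const_mul _)).const_mul _
  have hbint : ∫ s, b s = 2 ^ (k - 1) * ((∫ s, SchwartzMap.seminorm ℝ k n (u s)) +
      r ^ k * ∫ s, SchwartzMap.seminorm ℝ 0 n (u s)) := by
    rw [hb, integral_const_mul, integral_add (hu.integrable_seminorm k n)
      ((hu.integrable_seminorm 0 n).const_mul _), integral_const_mul]
  rw [← hbint]
  -- `‖x‖ ^ k` may vanish, so that it can only be moved to the other side in the second case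
  rcases (pow_nonneg (norm_nonneg x) k).eq_or_lt with h0 | h0
  · rw [← h0, zero_mul]
    exact integral_nonneg fun s => by positivity
  rw [mul_comm, ← le_div_iff₀ h0, ← integral_div]
  refine norm_iteratedFDeriv_integralOperator_le n hu _ (hbi.div_const _) fun s => ?_
  rw [le_div_iff₀ h0, mul_comm]
  set y := trajectory hu x s with hy
  have h1 : ‖x‖ ≤ ‖y‖ + r := by
    have h2 := norm_trajectory_sub_le hu x s
    have h3 := norm_sub_norm_le x (x - y)
    rw [sub_sub_cancel, norm_sub_rev] at h3
    linarith
  calc ‖x‖ ^ k * ‖iteratedFDeriv ℝ n (u s) y‖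
      ≤ 2 ^ (k - 1) * (‖y‖ ^ k + r ^ k) * ‖iteratedFDeriv ℝ n (u s) y‖ := by
        gcongr
        exact (pow_le_pow_left₀ (norm_nonneg x) h1 k).trans (add_pow_le (norm_nonneg y) hr0 k)
    _ = 2 ^ (k - 1) * (‖y‖ ^ k * ‖iteratedFDeriv ℝ n (u s) y‖ +
          r ^ k * ‖iteratedFDeriv ℝ n (u s) y‖) := by ring
    _ ≤ b s := by
        simp only [hb]
        gcongr
        · exact SchwartzMap.le_seminorm ℝ k n (u s) y
        · exact SchwartzMap.norm_iteratedFDeriv_le_seminorm ℝ (u s) n y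

variable (V) in
/-- The a priori estimate: the Schwartz seminorms of the displacement `x ↦ trajectory x - x`, as a
function with values in `C(I, V)`, are bounded in terms of the `L¹` seminorms of `u`. -/
lemma exists_norm_pow_mul_norm_iteratedFDeriv_le (k n : ℕ) {B : ℝ} (hB : 0 ≤ B) :
    ∃ C : ℝ, 0 ≤ C ∧ ∀ (u : I → 𝓢(V, V)) (hu : IsL1Curve u),
      (∀ i ≤ k, ∀ j ≤ n + 1, ∫ s, SchwartzMap.seminorm ℝ i j (u s) ≤ B) → ∀ x,
      ‖x‖ ^ k * ‖iteratedFDeriv ℝ n (fun x => trajectory hu x - constCurve V x) x‖ ≤ C := by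
  obtain ⟨D, hD1, hD⟩ := exists_forall_norm_iteratedFDeriv_le (V := V) (X := C(I, V)) n hB
    (R := 2 * Real.exp (4 * B)) (by positivity)
  set K : ℝ := 2 ^ (k - 1) * (B + B ^ k * B) with hK
  refine ⟨n.factorial * K * D ^ n, by positivity, fun u hu hBu x => ?_⟩
  have hm0 : ∀ s, 0 ≤ SchwartzMap.seminorm ℝ 0 1 (u s) := fun s => apply_nonneg _ _
  have hγ := contDiff_trajectory hu
  have hN := contDiff_integralOperator hu
  have hγD : ∀ i, 1 ≤ i → i ≤ n → ‖iteratedFDeriv ℝ i (trajectory hu) x‖ ≤ D := by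
    refine hD (constCurve V) (integralOperator hu) (trajectory hu) x norm_constCurve_le hN hγ
      (trajectory_eq hu) (fun i _ hi => ?_) fun y => ?_
    · exact (norm_iteratedFDeriv_integralOperator_le i hu _ (hu.integrable_seminorm 0 i)
        fun s => SchwartzMap.norm_iteratedFDeriv_le_seminorm ℝ (u s) i _).trans
          (hBu 0 (Nat.zero_le _) i (hi.trans n.le_succ))
    · have h1 := norm_le_of_fderiv hN (norm_lipschitzWeight_symm_sub_le hu) (trajectory hu x) y
      have h2 := norm_le_exp_mul_norm_expWeightEquiv_symm (hu.integrable_seminorm 0 1) hm0 y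
      have h3 := norm_expWeightEquiv_symm_le (hu.integrable_seminorm 0 1) hm0
        (y - fderiv ℝ (integralOperator hu) (trajectory hu x) y)
      have h4 : Real.exp (4 * ∫ s, SchwartzMap.seminorm ℝ 0 1 (u s)) ≤ Real.exp (4 * B) :=
        Real.exp_le_exp.2 (mul_le_mul_of_nonneg_left
          (hBu 0 (Nat.zero_le _) 1 (by omega)) (by norm_num))
      calc ‖y‖ ≤ _ := h2
        _ ≤ Real.exp (4 * B) *
            (2 * ‖y - fderiv ℝ (integralOperator hu) (trajectory hu x) y‖) := by
          gcongr
          exact h1.trans (mul_le_mul_of_nonneg_left h3 zero_le_two)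
        _ = _ := by ring
  have hη : (fun x => trajectory hu x - constCurve V x) =
      integralOperator hu ∘ trajectory hu := by
    ext1 x
    exact sub_eq_iff_eq_add'.2 (trajectory_eq hu x)
  rw [hη]
  rcases (pow_nonneg (norm_nonneg x) k).eq_or_lt with h0 | h0
  · rw [← h0, zero_mul]
    positivity
  rw [mul_comm, ← le_div_iff₀ h0]
  refine (norm_iteratedFDeriv_comp_le (C := K / ‖x‖ ^ k) (D := D) hN hγ
    (by exact_mod_cast le_top) x (fun i hi => ?_)
    fun i h1 h2 => (hγD i h1 h2).trans (le_self_pow₀ hD1 (by omega))).trans (le_of_eq (by ring))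
  rw [le_div_iff₀ h0, mul_comm]
  refine (norm_pow_mul_norm_iteratedFDeriv_integralOperator_le hu k i x).trans ?_
  rw [hK]
  have hnn : ∀ j, 0 ≤ ∫ s, SchwartzMap.seminorm ℝ 0 j (u s) :=
    fun j => integral_nonneg fun _ => apply_nonneg _ _
  have h00 := hnn 0
  gcongr
  · exact hBu k le_rfl i (by omega)
  · exact hBu 0 (Nat.zero_le _) 0 (Nat.zero_le _)
  · exact hBu 0 (Nat.zero_le _) i (by omega)

lemma contDiff_displacement (hu : IsL1Curve u) :
    ContDiff ℝ ∞ fun x => trajectory hu x - constCurve V x :=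
  (contDiff_trajectory hu).sub (constCurve V).contDiff

lemma norm_iteratedFDeriv_displacement_apply_le (hu : IsL1Curve u) (t : I) (n : ℕ) (x : V) :
    ‖iteratedFDeriv ℝ n (fun x => trajectory hu x t - x) x‖ ≤
      ‖iteratedFDeriv ℝ n (fun x => trajectory hu x - constCurve V x) x‖ := by
  set e : C(I, V) →L[ℝ] V := ContinuousMap.evalCLM ℝ t with he
  have hen : ‖e‖ ≤ 1 := ContinuousLinearMap.opNorm_le_bound _ zero_le_one fun γ => by
    rw [one_mul]
    exact γ.norm_coe_le_norm t
  exact (e.norm_iteratedFDeriv_comp_left (contDiff_displacement hu).contDiffAt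
    (by exact_mod_cast le_top)).trans (mul_le_of_le_one_left (norm_nonneg _) hen)

/-- The displacement `x ↦ Φ(t, x) - x` of the flow `Φ` of `u`, as a Schwartz function. -/
def displacement (hu : IsL1Curve u) (t : I) : 𝓢(V, V) where
  toFun x := trajectory hu x t - x
  smooth' := (ContinuousMap.evalCLM ℝ t : C(I, V) →L[ℝ] V).contDiff.comp (contDiff_displacement hu)
  decay' k n := by
    obtain ⟨B, hB0, hB⟩ := exists_bound_integral_seminorm u k (n + 1)
    obtain ⟨C, -, hC⟩ := exists_norm_pow_mul_norm_iteratedFDeriv_le V k n hB0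
    refine ⟨C, fun x => le_trans ?_ (hC u hu hB x)⟩
    gcongr
    exact norm_iteratedFDeriv_displacement_apply_le hu t n x

lemma displacement_apply (hu : IsL1Curve u) (t : I) (x : V) :
    displacement hu t x = trajectory hu x t - x := rfl

variable (V) in
lemma exists_seminorm_displacement_le (k n : ℕ) {B : ℝ} (hB : 0 ≤ B) :
    ∃ C : ℝ, ∀ (u : I → 𝓢(V, V)) (hu : IsL1Curve u),
      (∀ i ≤ k, ∀ j ≤ n + 1, ∫ s, SchwartzMap.seminorm ℝ i j (u s) ≤ B) → ∀ t,
      SchwartzMap.seminorm ℝ k n (displacement hu t) ≤ C := by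
  obtain ⟨C, hC0, hC⟩ := exists_norm_pow_mul_norm_iteratedFDeriv_le V k n hB
  refine ⟨C, fun u hu hBu t => SchwartzMap.seminorm_le_bound ℝ k n _ hC0 fun x =>
    le_trans ?_ (hC u hu hBu x)⟩
  gcongr
  exact norm_iteratedFDeriv_displacement_apply_le hu t n x

lemma norm_trajectory_sub_trajectory_le (hu : IsL1Curve u) (x : V) {s t : I} (hst : s ≤ t) :
    ‖trajectory hu x t - trajectory hu x s‖ ≤
      (∫ r in Set.Iic t, SchwartzMap.seminorm ℝ 0 0 (u r)) -
        ∫ r in Set.Iic s, SchwartzMap.seminorm ℝ 0 0 (u r) := by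
  have hi := hu.integrable_apply (trajectory hu x)
  rw [(isFlow_trajectory hu).eq_integral t x, (isFlow_trajectory hu).eq_integral s x,
    add_sub_add_left_eq_sub, setIntegral_Iic_sub hi hst,
    setIntegral_Iic_sub (hu.integrable_seminorm 0 0) hst]
  exact norm_integral_le_of_norm_le (hu.integrable_seminorm 0 0).integrableOn
    (ae_of_all _ fun r => SchwartzMap.norm_le_seminorm ℝ _ _)

lemma continuous_displacement (hu : IsL1Curve u) : Continuous (displacement hu) := by
  rw [continuous_iff_continuousAt]
  intro t
  rw [ContinuousAt, ← tendsto_sub_nhds_zero_iff]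
  refine tendsto_zero_of_bounded_of_tendsto_seminorm_zero (fun k n => ?_) ?_
  · obtain ⟨B, hB0, hB⟩ := exists_bound_integral_seminorm u k (n + 1)
    obtain ⟨C, hC⟩ := exists_seminorm_displacement_le V k n hB0
    exact ⟨C + C, Eventually.of_forall fun s =>
      (map_sub_le_add _ _ _).trans (add_le_add (hC u hu hB s) (hC u hu hB t))⟩
  · set M : I → ℝ := fun t => ∫ r in Set.Iic t, SchwartzMap.seminorm ℝ 0 0 (u r) with hM
    have hMc : Continuous M := continuous_setIntegral_Iic (hu.integrable_seminorm 0 0)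
    have h0 : Tendsto (fun s => |M s - M t|) (𝓝 t) (𝓝 0) := by
      have := ((hMc.tendsto t).sub_const (M t)).abs
      rwa [sub_self, abs_zero] at this
    refine squeeze_zero (fun _ => apply_nonneg _ _) (fun s => ?_) h0
    refine SchwartzMap.seminorm_le_bound ℝ 0 0 _ (abs_nonneg _) fun x => ?_
    rw [pow_zero, one_mul, norm_iteratedFDeriv_zero, sub_apply, displacement_apply,
      displacement_apply, sub_sub_sub_cancel_right]
    rcases le_total s t with h | h
    · rw [norm_sub_rev, abs_sub_comm]
      exact (norm_trajectory_sub_trajectory_le hu x h).trans (le_abs_self _)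
    · exact (norm_trajectory_sub_trajectory_le hu x h).trans (le_abs_self _)

/-- The curve `t ↦ (x ↦ Φ(t, x) - x)` of Schwartz functions, for the flow `Φ` of `u`. -/
def displacementCurve (hu : IsL1Curve u) : C(I, 𝓢(V, V)) :=
  ⟨displacement hu, continuous_displacement hu⟩

lemma displacementCurve_apply (hu : IsL1Curve u) (t : I) (x : V) :
    displacementCurve hu t x = trajectory hu x t - x := rfl

/-- Trajectories depend on the time-dependent vector field in a locally Lipschitz manner. -/
lemma norm_trajectory_sub_trajectory_le_of_sub {v : I → 𝓢(V, V)} (hu : IsL1Curve u)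
    (hv : IsL1Curve v) (huv : Integrable fun s => SchwartzMap.seminorm ℝ 0 0 (u s - v s)) (x : V) :
    ‖trajectory hu x - trajectory hv x‖ ≤
      Real.exp (4 * ∫ s, SchwartzMap.seminorm ℝ 0 1 (u s)) *
        (2 * ∫ s, SchwartzMap.seminorm ℝ 0 0 (u s - v s)) := by
  have hm0 : ∀ s, 0 ≤ SchwartzMap.seminorm ℝ 0 1 (u s) := fun s => apply_nonneg _ _
  set a := trajectory hu x with ha
  set b := trajectory hv x with hb
  have h1 : ‖integralOperator hu b - integralOperator hv b‖ ≤
      ∫ s, SchwartzMap.seminorm ℝ 0 0 (u s - v s) := by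
    rw [integralOperator, integralOperator, ← ContinuousLinearMap.map_sub]
    refine ((primitive (F := V)).le_of_opNorm_le norm_primitive_le _).trans ?_
    rw [one_mul]
    refine norm_le_integral_of_ae_le huv ?_
    filter_upwards [Lp.coeFn_sub (superposition hu b) (superposition hv b),
      coeFn_superposition hu b, coeFn_superposition hv b] with s h1 h2 h3
    rw [h1, Pi.sub_apply, h2, h3]
    exact SchwartzMap.norm_le_seminorm ℝ (u s - v s) (b s)
  have h2 : a - b = (integralOperator hu a - integralOperator hu b) +
      (integralOperator hu b - integralOperator hv b) := by
    have ha' := trajectory_eq hu x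
    have hb' := trajectory_eq hv x
    rw [← ha] at ha'
    rw [← hb] at hb'
    nth_rewrite 1 [ha', hb']
    abel
  have h3 := norm_lipschitzWeight_symm_sub_le hu a b
  have h4 := norm_expWeightEquiv_symm_le (hu.integrable_seminorm 0 1) hm0
    (integralOperator hu b - integralOperator hv b)
  have h5 := norm_add_le ((lipschitzWeight hu).symm (integralOperator hu a - integralOperator hu b))
    ((lipschitzWeight hu).symm (integralOperator hu b - integralOperator hv b))
  rw [← map_add, ← h2] at h5
  refine (norm_le_exp_mul_norm_expWeightEquiv_symm (hu.integrable_seminorm 0 1) hm0 _).trans ?_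
  gcongr
  change ‖(lipschitzWeight hu).symm (a - b)‖ ≤ _
  linarith

/-- Continuous dependence of the flow on the time-dependent vector field. -/
lemma tendsto_displacementCurve {ι : Type*} {l : Filter ι} {v : ι → I → 𝓢(V, V)}
    (hu : IsL1Curve u) (hv : ∀ i, IsL1Curve (v i)) (huv : ∀ i, IsL1Curve fun s => u s - v i s)
    (h : ∀ k n, Tendsto (fun i => ∫ s, SchwartzMap.seminorm ℝ k n (u s - v i s)) l (𝓝 0)) :
    Tendsto (fun i => displacementCurve (hv i)) l (𝓝 (displacementCurve hu)) := by
  rw [ContinuousMap.tendsto_iff_tendstoUniformly, tendstoUniformly_iff_tendsto,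
    uniformity_eq_comap_nhds_zero, tendsto_comap_iff]
  refine tendsto_zero_of_bounded_of_tendsto_seminorm_zero (fun k n => ?_) ?_
  · obtain ⟨B, hB0, hB⟩ := exists_bound_integral_seminorm u k (n + 1)
    obtain ⟨C, hC⟩ := exists_seminorm_displacement_le V k n (add_nonneg hB0 zero_le_one)
    have hev : ∀ᶠ i in l, ∀ a ∈ Finset.range (k + 1), ∀ b ∈ Finset.range (n + 2),
        ∫ s, SchwartzMap.seminorm ℝ a b (u s - v i s) < 1 := by
      rw [eventually_all_finset]
      intro a _
      rw [eventually_all_finset]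
      exact fun b _ => (h a b).eventually (gt_mem_nhds one_pos)
    refine ⟨C + C, ?_⟩
    have hev' : ∀ᶠ i in l, ∀ t, SchwartzMap.seminorm ℝ k n (displacement (hv i) t) ≤ C := by
      filter_upwards [hev] with i hi
      refine hC _ (hv i) fun a ha b hb => ?_
      have h1 := hi a (Finset.mem_range.2 (by omega)) b (Finset.mem_range.2 (by omega))
      calc ∫ s, SchwartzMap.seminorm ℝ a b (v i s)
          ≤ ∫ s, (SchwartzMap.seminorm ℝ a b (u s) + SchwartzMap.seminorm ℝ a b (u s - v i s)) := by
            refine integral_mono ((hv i).integrable_seminorm a b)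
              ((hu.integrable_seminorm a b).add ((huv i).integrable_seminorm a b)) fun s => ?_
            have := map_sub_le_add (SchwartzMap.seminorm ℝ a b) (u s) (u s - v i s)
            rwa [sub_sub_cancel] at this
        _ = (∫ s, SchwartzMap.seminorm ℝ a b (u s)) +
              ∫ s, SchwartzMap.seminorm ℝ a b (u s - v i s) :=
            integral_add (hu.integrable_seminorm a b) ((huv i).integrable_seminorm a b)
        _ ≤ B + 1 := add_le_add (hB a ha b hb) h1.le
    filter_upwards [hev'.prod_inl ⊤] with q hq
    refine (map_sub_le_add _ _ _).trans (add_le_add (hq q.2) (hC u hu (fun a ha b hb => ?_) q.2))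
    exact (hB a ha b hb).trans (by linarith)
  · have h1 := ((h 0 0).const_mul 2).const_mul
      (Real.exp (4 * ∫ s, SchwartzMap.seminorm ℝ 0 1 (u s)))
    rw [mul_zero, mul_zero] at h1
    refine squeeze_zero (fun _ => apply_nonneg _ _) (fun q => ?_) (h1.comp tendsto_fst)
    refine SchwartzMap.seminorm_le_bound ℝ 0 0 _
      (mul_nonneg (Real.exp_pos _).le (mul_nonneg zero_le_two
        (integral_nonneg fun _ => apply_nonneg _ _))) fun x => ?_
    rw [pow_zero, one_mul, norm_iteratedFDeriv_zero, Function.comp_apply, sub_apply,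
      displacementCurve_apply, displacementCurve_apply, sub_sub_sub_cancel_right, norm_sub_rev]
    exact ((trajectory hu x - trajectory (hv q.1) x).norm_coe_le_norm q.2).trans
      (norm_trajectory_sub_trajectory_le_of_sub hu (hv q.1) ((huv q.1).integrable_seminorm 0 0) x)

end Flow

/-! ### Passage to the quotient and to functions with support in a compact set -/

section Transfer

lemma PreL1.withSeminorms (E : Type*) [AddCommGroup E] [Module ℝ E] [TopologicalSpace E] :
    WithSeminorms (PreL1.seminorms E) := ⟨rfl⟩

universe v

variable {V : Type v} [NormedAddCommGroup V] [NormedSpace ℝ V]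
  {E : Type*} [AddCommGroup E] [Module ℝ E] [TopologicalSpace E]

/-- The pullback of a Schwartz seminorm along a continuous linear map. -/
def pullbackSeminorm (T : E →L[ℝ] 𝓢(V, V)) (k n : ℕ) : {p : Seminorm ℝ E // Continuous p} :=
  ⟨(SchwartzMap.seminorm ℝ k n : Seminorm ℝ 𝓢(V, V)).comp T.toLinearMap,
    (continuous_seminorm k n).comp T.continuous⟩

lemma PreL1.integral_seminorm_sub (T : E →L[ℝ] 𝓢(V, V)) (u w : PreL1 E) (k n : ℕ) :
    ∫ s, SchwartzMap.seminorm ℝ k n (T (u s) - T (w s)) =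
      PreL1.seminorms E (pullbackSeminorm T k n) (u - w) :=
  integral_congr_ae (ae_of_all _ fun s =>
    congrArg (SchwartzMap.seminorm ℝ k n) (map_sub T (u s) (w s)).symm)

lemma PreL1.isL1Curve_sub (T : E →L[ℝ] 𝓢(V, V)) (u w : PreL1 E) :
    IsL1Curve fun s => T (u s) - T (w s) := by
  have h := (u - w).isL1Curve.comp T
  have h' : (fun s => T ((u - w) s)) = fun s => T (u s) - T (w s) :=
    funext fun s => map_sub T (u s) (w s)
  rwa [h'] at h

variable [CompleteSpace V]

lemma continuous_displacementCurve (T : E →L[ℝ] 𝓢(V, V)) :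
    Continuous fun u : PreL1 E => displacementCurve (u.isL1Curve.comp T) := by
  have := (PreL1.withSeminorms E).topologicalAddGroup
  rw [continuous_iff_continuousAt]
  intro u
  refine tendsto_displacementCurve (u.isL1Curve.comp T) (fun w => w.isL1Curve.comp T)
    (fun w => PreL1.isL1Curve_sub T u w) fun k n => ?_
  simp_rw [PreL1.integral_seminorm_sub T]
  have hc : Continuous fun w : PreL1 E =>
      PreL1.seminorms E (pullbackSeminorm T k n) (u - w) :=
    ((PreL1.withSeminorms E).continuous_seminorm (pullbackSeminorm T k n)).comp
      (continuous_const.sub continuous_id)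
  have h := hc.tendsto u
  rwa [sub_self, map_zero] at h

/-- The flow does not depend on the representative of the time-dependent vector field. -/
lemma displacementCurve_eq_of_sub_mem (T : E →L[ℝ] 𝓢(V, V)) {u w : PreL1 E}
    (h : u - w ∈ PreL1.nullSubmodule E) :
    displacementCurve (u.isL1Curve.comp T) = displacementCurve (w.isL1Curve.comp T) := by
  ext t x
  have h1 := norm_trajectory_sub_trajectory_le_of_sub (u.isL1Curve.comp T) (w.isL1Curve.comp T)
    ((PreL1.isL1Curve_sub T u w).integrable_seminorm 0 0) x
  rw [PreL1.integral_seminorm_sub T, h, mul_zero, mul_zero, norm_le_zero_iff, sub_eq_zero] at h1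
  rw [displacementCurve_apply, displacementCurve_apply, h1]

/-- A continuous map on `ℒ¹([0,1], E)` which gives the displacements of the flows induces a
continuous flow map on `L¹([0,1], E)`. -/
lemma exists_isFlowMap {E' : Type*} [FunLike E V V] [AddCommGroup E'] [Module ℝ E']
    [TopologicalSpace E'] [FunLike E' V V] (T : E →L[ℝ] 𝓢(V, V)) (hT : ∀ e, ⇑(T e) = e)
    (ψ : PreL1 E → C(I, E')) (hψc : Continuous ψ)
    (hψ : ∀ u t, ⇑(ψ u t) = displacementCurve (u.isL1Curve.comp T) t) :
    ∃ φ : L1 E → C(I, E'), IsFlowMap φ ∧ Continuous φ := by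
  have hlift : ∀ u w : PreL1 E, (PreL1.nullSubmodule E).quotientRel u w → ψ u = ψ w := by
    intro u w h
    rw [Submodule.quotientRel_def] at h
    ext t : 1
    apply DFunLike.coe_injective
    rw [hψ, hψ, displacementCurve_eq_of_sub_mem T h]
  refine ⟨Quotient.lift ψ hlift, fun u => ?_, hψc.quotient_lift hlift⟩
  have hu : (fun t x => x + (Quotient.lift ψ hlift) (Submodule.Quotient.mk u) t x) =
      fun t x => trajectory (u.isL1Curve.comp T) x t := by
    ext t x
    change x + ψ u t x = _
    rw [hψ, displacementCurve_apply, add_sub_cancel]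
  have hTu : (fun t => ⇑(u t)) = fun t => ⇑(T (u t)) := funext fun t => (hT _).symm
  rw [hu, hTu]
  exact ⟨isFlow_trajectory _, fun Φ hΦ => hΦ.eq_trajectory (u.isL1Curve.comp T)⟩

end Transfer

section CompactSupport

variable {V F : Type*} [NormedAddCommGroup V] [NormedSpace ℝ V] [NormedAddCommGroup F]
  [NormedSpace ℝ F] {K : Compacts V}

/-- The inclusion of the space of smooth functions with support in `K` into the Schwartz space, as a
linear map. -/
def toSchwartzLM (K : Compacts V) : 𝓓_{K}(V, F) →ₗ[ℝ] 𝓢(V, F) where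
  toFun f := f.hasCompactSupport.toSchwartzMap f.contDiff
  map_add' f g := by ext; rfl
  map_smul' c f := by ext; rfl

@[simp]
lemma coe_toSchwartzLM (f : 𝓓_{K}(V, F)) : ⇑(toSchwartzLM K f) = f := rfl

lemma exists_norm_le {V : Type*} [NormedAddCommGroup V] (K : Compacts V) :
    ∃ R : ℝ, 0 ≤ R ∧ ∀ x ∈ K, ‖x‖ ≤ R := by
  obtain ⟨R, hR⟩ := K.isCompact.isBounded.exists_norm_le
  exact ⟨max R 0, le_max_right _ _, fun x hx => (hR x hx).trans (le_max_left _ _)⟩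

/-- The topology of `𝓓_K` is induced by the Schwartz space: weights are bounded on `K`. -/
lemma isInducing_toSchwartzLM (K : Compacts V) :
    IsInducing (toSchwartzLM K : 𝓓_{K}(V, F) →ₗ[ℝ] 𝓢(V, F)) := by
  obtain ⟨R, hR0, hR⟩ := exists_norm_le K
  have h1 : WithSeminorms (ContDiffMapSupportedIn.seminorm ℝ V F ⊤ K) :=
    ContDiffMapSupportedIn.withSeminorms ℝ V F ⊤ K
  have h2 : WithSeminorms ((schwartzSeminormFamily ℝ V F).comp
      (toSchwartzLM K : 𝓓_{K}(V, F) →ₗ[ℝ] 𝓢(V, F))) := by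
    refine h1.congr (Seminorm.IsBounded.of_real ?_) (Seminorm.IsBounded.of_real ?_)
    · rintro ⟨k, n⟩
      refine ⟨{n}, R ^ k, fun f => ?_⟩
      rw [Finset.sup_singleton]
      refine SchwartzMap.seminorm_le_bound ℝ k n _
        (mul_nonneg (pow_nonneg hR0 k) (apply_nonneg _ _)) fun x => ?_
      rw [coe_toSchwartzLM, LinearMap.id_apply]
      by_cases hx : x ∈ K
      · exact mul_le_mul (pow_le_pow_left₀ (norm_nonneg x) (hR x hx) k)
          (ContDiffMapSupportedIn.norm_iteratedFDeriv_apply_le_seminorm_top ℝ)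
          (norm_nonneg _) (pow_nonneg hR0 k)
      · rw [f.iteratedFDeriv_zero_on_compl hx, Pi.zero_apply, norm_zero, mul_zero]
        exact mul_nonneg (pow_nonneg hR0 k) (apply_nonneg _ _)
    · intro n
      refine ⟨{(0, n)}, 1, fun f => ?_⟩
      rw [Finset.sup_singleton, one_mul, LinearMap.id_apply]
      refine (ContDiffMapSupportedIn.seminorm_top_le_iff ℝ (apply_nonneg _ _) n f).2 fun x _ => ?_
      exact SchwartzMap.norm_iteratedFDeriv_le_seminorm ℝ (toSchwartzLM K f) n x
  refine ⟨?_⟩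
  rw [h2.topology_eq_withSeminorms]
  let _ : TopologicalSpace 𝓓_{K}(V, F) := induced (toSchwartzLM K) inferInstance
  exact (LinearMap.withSeminorms_induced (schwartz_withSeminorms ℝ V F)
    (toSchwartzLM K)).topology_eq_withSeminorms.symm

/-- The inclusion of the space of smooth functions with support in `K` into the Schwartz space. -/
def toSchwartzCLM (K : Compacts V) : 𝓓_{K}(V, F) →L[ℝ] 𝓢(V, F) where
  toLinearMap := toSchwartzLM K
  cont := (isInducing_toSchwartzLM K).continuous

end CompactSupport

section CompactSupportFlow

universe v

variable {V : Type v} [NormedAddCommGroup V] [NormedSpace ℝ V] [CompleteSpace V] {K : Compacts V}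

/-- Points at which the vector field vanishes at all times are fixed by the flow. -/
lemma displacement_eq_zero {u : I → 𝓢(V, V)} (hu : IsL1Curve u) {x : V} (hx : ∀ s, u s x = 0)
    (t : I) : displacement hu t x = 0 := by
  have h : constCurve V x = trajectory hu x := eq_trajectory hu (by
    ext t
    simp [integralOperator_apply, hx])
  rw [displacement_apply, ← h, constCurve_apply, sub_self]

/-- The displacements of the flow of a time-dependent vector field with support in `K`, as a curve
of smooth functions with support in `K`. -/
def supportedDisplacementCurve (u : PreL1 𝓓_{K}(V, V)) : C(I, 𝓓_{K}(V, V)) where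
  toFun t := ⟨displacement (u.isL1Curve.comp (toSchwartzCLM K)) t, (displacement _ t).smooth ⊤,
    fun _ hx => displacement_eq_zero _ (fun s => (u s).zero_on_compl hx) t⟩
  continuous_toFun := (isInducing_toSchwartzLM K).continuous_iff.2
    (continuous_displacement (u.isL1Curve.comp (toSchwartzCLM K)))

lemma continuous_supportedDisplacementCurve :
    Continuous (supportedDisplacementCurve : PreL1 𝓓_{K}(V, V) → C(I, 𝓓_{K}(V, V))) :=
  (ContinuousMap.isInducing_postcomp ⟨toSchwartzCLM K, (toSchwartzCLM K).continuous⟩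
    (isInducing_toSchwartzLM K)).continuous_iff.2 (continuous_displacementCurve (toSchwartzCLM K))

end CompactSupportFlow

end SeminormIntegral

end

theorem theorem5p4 (d : ℕ) :
    (∃ φ : SeminormIntegral.L1 𝓢(EuclideanSpace ℝ (Fin d), EuclideanSpace ℝ (Fin d)) →
        C(I, 𝓢(EuclideanSpace ℝ (Fin d), EuclideanSpace ℝ (Fin d))),
      SeminormIntegral.IsFlowMap φ ∧ Continuous φ) ∧
    (∀ K : Compacts (EuclideanSpace ℝ (Fin d)),
      ∃ φ : SeminormIntegral.L1 𝓓_{K}(EuclideanSpace ℝ (Fin d), EuclideanSpace ℝ (Fin d)) →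
          C(I, 𝓓((⊤ : Opens (EuclideanSpace ℝ (Fin d))), EuclideanSpace ℝ (Fin d))),
        SeminormIntegral.IsFlowMap φ ∧ Continuous φ) := by
  refine ⟨?_, fun K => ?_⟩
  · exact SeminormIntegral.exists_isFlowMap (ContinuousLinearMap.id ℝ _) (fun _ => rfl) _
      (SeminormIntegral.continuous_displacementCurve _) fun _ _ => rfl
  · have hK : (K : Set (EuclideanSpace ℝ (Fin d))) ⊆
        ((⊤ : Opens (EuclideanSpace ℝ (Fin d))) : Set (EuclideanSpace ℝ (Fin d))) :=
      Set.subset_univ _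
    exact SeminormIntegral.exists_isFlowMap (SeminormIntegral.toSchwartzCLM K) (fun _ => rfl)
      (fun u => ContinuousMap.comp
        ⟨TestFunction.ofSupportedIn hK, TestFunction.continuous_ofSupportedIn hK⟩
        (SeminormIntegral.supportedDisplacementCurve u))
      ((ContinuousMap.continuous_postcomp _).comp
        SeminormIntegral.continuous_supportedDisplacementCurve) fun _ _ => rfl
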